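/- All graphs are finite, simple and undirected. For a graph $G$ let $\mathcal H(G)$ be its support hypergraph: its vertex set is $V(G)$, and its hyperedges are a hyperedge $\{v\}$ for every $v\in V(G)$ and a hyperedge $\{u,v\}$ for every edge $uv\in E(G)$. In a hypergraph (parallel hyperedges are allowed) let, for a set $A$ of hyperedges, $V(A)$ be the union of their vertex sets, $\overline A$ the complement of $A$, $\mathrm{bd}(A)=V(A)\cap V(\overline A)$, $\lambda(A)=|\mathrm{bd}(A)|$, $\mathrm{int}(A)=V(A)\setminus \mathrm{bd}(A)$, and let $\mathrm{itw}(A)$ be the treewidth of the subgraph of the primal graph induced by $\mathrm{int}(A)$. The set $A$ is well-linked if every bipartition $(A_1,A_2)$ of $A$ satisfies $\lambda(A_1)\ge\lambda(A)$ or $\lambda(A_2)\ge\lambda(A)$. It is internally connected if it is non-empty and has no bipartition into two non-empty sets $A_1,A_2$ with $\mathrm{bd}(A_1),\mathrm{bd}(A_2)\subseteq\mathrm{bd}(A)$. The internal components of $A$ are its inclusion-maximal internally connected subsets. A rooted superbranch decomposition $\mathcal T=(T,\mathcal L)$ of a hypergraph consists of a (finite) rooted tree $T$ in which every non-leaf node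 has at least two children, and a bijection $\mathcal L$ from the leaves of $T$ to the hyperedges. For a node $t$, $\mathcal L[t]$ is the set of hyperedges assigned to the leaves that are descendants of $t$. $\mathcal T$ is downwards well-linked if $\mathcal L[t]$ is well-linked for every node $t$, and has adhesion size $\alpha$ if $\lambda(\mathcal L[t])\le\alpha$ for every non-root node $t$. The torso of the root $r$ is the hypergraph with one hyperedge $e_s$, of vertex set $\mathrm{bd}(\mathcal L[s])$, for every child $s$ of $r$. For $B\subseteq E(\mathrm{torso}(r))$ let $B\vartriangleright\mathcal T=\bigcup_{e_s\in B}\mathcal L[s]$. Let $\Delta(r)$ be the number of children of $r$. A treewidth-$\eta$-modulator of $G$ is a set $X\subseteq V(G)$ such that $G\setminus X$ has treewidth at most $\eta$. **Lemma.** There are computable functions $\gamma=\gamma(H,\eta)$, $C=C(H,\eta)$ and $c=c(H,\eta,\alpha)$ with values in the non-negative integers, defined for all graphs $H$, integers $\eta$ and integers $\alpha\ge 0$, such that the following holds for all such $H,\eta,\alpha$ and every integer $k\ge 1$. Let $G$ be a graph that does not contain $H$ as a topological minor and that has a treewidth-$\eta$-modulator of size $k$. Let $\mathcal T=(T,\mathcal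 L)$ be a downwards well-linked superbranch decomposition of $\mathcal H(G)$ with root $r$ and adhesion size $\alpha$. If $\Delta(r)\ge c\cdot k$, then there is a set $B\subseteq E(\mathrm{torso}(r))$ such that 1. $\lambda(B)\le\gamma$ (in $\mathrm{torso}(r)$), 2. $\mathrm{itw}(B\vartriangleright\mathcal T)\le\gamma$ (in $\mathcal H(G)$), 3. $2^{\gamma+2}\le|B|\le C\cdot\max(\alpha,1)$, and 4. every internal component $B'$ of $B$ in $\mathrm{torso}(r)$ satisfies $\mathrm{bd}(B')=\mathrm{bd}(B)$. -/

import Mathlib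

noncomputable section

namespace Mergeable

universe u v w

/-! ### Finite graphs as inputs of computable functions -/

/-- A finite graph given as a finite object: the number of vertices and a list of edges. -/
abbrev GraphCode : Type := ℕ × List (ℕ × ℕ)

/-- The simple graph on `{0, …, n - 1}` that is given by the code `(n, edges)`. -/
def GraphCode.graph (c : GraphCode) : SimpleGraph (Fin c.1) :=
  SimpleGraph.fromRel fun i j => ((i : ℕ), (j : ℕ)) ∈ c.2

/-- Every finite simple graph is, up to isomorphism, given by a code. -/
theorem GraphCode.exists_iso {W : Type u} [Finite W] (H : SimpleGraph W) :
    ∃ c : GraphCode, Nonempty (H ≃g c.graph) := by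
  classical
  obtain ⟨n, ⟨f⟩⟩ := Finite.exists_equiv_fin W
  refine ⟨(n, ((Finset.univ : Finset (Fin n × Fin n)).filter
    fun p => H.Adj (f.symm p.1) (f.symm p.2)).toList.map fun p => ((p.1 : ℕ), (p.2 : ℕ))),
    ⟨⟨f, ?_⟩⟩⟩
  intro a b
  have key : ∀ x y : Fin n, (((x : ℕ), (y : ℕ)) ∈ ((Finset.univ : Finset (Fin n × Fin n)).filter
      fun p => H.Adj (f.symm p.1) (f.symm p.2)).toList.map fun p => ((p.1 : ℕ), (p.2 : ℕ))) ↔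
      H.Adj (f.symm x) (f.symm y) := by
    intro x y
    simp only [List.mem_map, Finset.mem_toList, Finset.mem_filter, Finset.mem_univ, true_and,
      Prod.exists, Prod.mk.injEq]
    constructor
    · rintro ⟨x', y', h, hx, hy⟩
      rw [← Fin.ext hx, ← Fin.ext hy]
      exact h
    · intro h
      exact ⟨x, y, h, rfl, rfl⟩
  have h1 := key (f a) (f b)
  have h2 := key (f b) (f a)
  rw [Equiv.symm_apply_apply, Equiv.symm_apply_apply] at h1 h2
  rw [GraphCode.graph, SimpleGraph.fromRel_adj]
  refine ⟨fun h => ?_, fun h => ⟨fun e => h.ne (f.injective e), Or.inl (h1.2 h)⟩⟩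
  rcases h.2 with h | h
  · exact h1.1 h
  · exact (h2.1 h).symm

/-! ### Topological minors, treewidth, modulators -/

/-- `H` is a topological minor of `G`: a subdivision of `H` is a subgraph of `G`. The vertices of
`H` are mapped injectively to branch vertices, and the edges of `H` to paths of `G` between the
corresponding branch vertices. A path contains no branch vertices but its ends, and the paths of
distinct edges have only branch vertices in common. -/
def IsTopologicalMinor {W : Type u} {V : Type v} (H : SimpleGraph W) (G : SimpleGraph V) : Prop :=
  ∃ (f : W ↪ V) (P : ∀ a b : W, H.Adj a b → G.Walk (f a) (f b)),
    (∀ a b h, (P a b h).IsPath) ∧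
    (∀ a b (h : H.Adj a b), P b a h.symm = (P a b h).reverse) ∧
    (∀ a b h x, f x ∈ (P a b h).support → x = a ∨ x = b) ∧
    (∀ a b h a' b' h', s(a, b) ≠ s(a', b') →
      ∀ y, y ∈ (P a b h).support → y ∈ (P a' b' h').support → y ∈ Set.range f)

/-- `(T, bag)` is a tree decomposition of `G`. -/
def IsTreeDecomposition {V : Type u} {N : Type v} (G : SimpleGraph V) (T : SimpleGraph N)
    (bag : N → Finset V) : Prop :=
  T.IsTree ∧
  (∀ a, ∃ x, a ∈ bag x) ∧
  (∀ a b, G.Adj a b → ∃ x, a ∈ bag x ∧ b ∈ bag x) ∧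
  (∀ a, (T.induce {x | a ∈ bag x}).Connected)

/-- The treewidth of a finite graph: the minimum over all its tree decompositions of the maximum
size of a bag minus one. It is `-1` for the graph without vertices. -/
def treewidth {V : Type u} (G : SimpleGraph V) : ℤ :=
  sInf {w : ℤ | ∃ (n : ℕ) (T : SimpleGraph (Fin n)) (bag : Fin n → Finset V),
    IsTreeDecomposition G T bag ∧ ∀ x, ((bag x).card : ℤ) - 1 ≤ w}

/-- `X` is a treewidth-`η`-modulator of `G`. -/
def IsTreewidthModulator {V : Type u} (G : SimpleGraph V) (η : ℤ) (X : Finset V) : Prop :=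
  treewidth (G.induce ((X : Set V)ᶜ)) ≤ η

/-! ### Hypergraphs with parallel hyperedges -/

/-- A hypergraph with vertices `V`, hyperedges `E`, and the vertex set `inc e` of each hyperedge
`e`. Distinct hyperedges may have the same vertex set. -/
structure MultiHypergraph (V : Type u) (E : Type v) where
  inc : E → Set V

namespace MultiHypergraph

variable {V : Type u} {E : Type v} (X : MultiHypergraph V E)

/-- The vertices that are incident to a hyperedge of `A`. -/
def verts (A : Set E) : Set V := {x | ∃ e ∈ A, x ∈ X.inc e}

/-- The boundary of `A`. -/
def bd (A : Set E) : Set V := X.verts A ∩ X.verts Aᶜ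

/-- The internal vertices of `A`. -/
def interior (A : Set E) : Set V := X.verts A \ X.bd A

/-- The size `λ(A)` of the boundary. -/
def lam (A : Set E) : ℕ := (X.bd A).ncard

/-- The primal graph. -/
def primal : SimpleGraph V where
  Adj x y := x ≠ y ∧ ∃ e, x ∈ X.inc e ∧ y ∈ X.inc e
  symm := ⟨fun _ _ h => ⟨h.1.symm, h.2.imp fun _ he => ⟨he.2, he.1⟩⟩⟩
  loopless := ⟨fun _ h => h.1 rfl⟩

/-- The internal treewidth of `A`: the treewidth of the subgraph of the primal graph that is
induced by the internal vertices of `A`. -/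
def itw (A : Set E) : ℤ := treewidth (X.primal.induce (X.interior A))

/-- `A` is well-linked: in every bipartition of `A`, one of the parts has a boundary that is at
least as large as that of `A`. -/
def WellLinked (A : Set E) : Prop :=
  ∀ A₁ A₂ : Set E, A₁ ∪ A₂ = A → Disjoint A₁ A₂ → X.lam A ≤ X.lam A₁ ∨ X.lam A ≤ X.lam A₂

/-- `A` is internally connected: it is non-empty and has no bipartition into two non-empty sets
whose boundaries are contained in the boundary of `A`. -/
def InternallyConnected (A : Set E) : Prop :=
  A.Nonempty ∧ ¬ ∃ A₁ A₂ : Set E, A₁.Nonempty ∧ A₂.Nonempty ∧ A₁ ∪ A₂ = A ∧ Disjoint A₁ A₂ ∧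
    X.bd A₁ ⊆ X.bd A ∧ X.bd A₂ ⊆ X.bd A

/-- `A'` is an internal component of `A`: an inclusion-maximal internally connected subset. -/
def IsInternalComponent (A A' : Set E) : Prop :=
  Maximal (fun S => S ⊆ A ∧ X.InternallyConnected S) A'

end MultiHypergraph

/-- The support hypergraph of a graph: a hyperedge `{x}` for every vertex `x`, and a hyperedge
`{x, y}` for every edge `xy`. -/
def supportHypergraph {V : Type u} (G : SimpleGraph V) : MultiHypergraph V (V ⊕ G.edgeSet) where
  inc := Sum.elim (fun x => {x}) (fun e => {x | x ∈ (e : Sym2 V)})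

/-! ### Rooted trees and superbranch decompositions -/

section RootedTree

variable {N : Type w} (T : SimpleGraph N) (r : N)

/-- `s` is an ancestor of `t` in the tree `T` with root `r`: it lies on the path from `r` to `t`.
Every node is an ancestor of itself. -/
def IsAncestor (s t : N) : Prop := ∃ p : T.Walk r t, p.IsPath ∧ s ∈ p.support

/-- The children of `t`: the neighbours of `t` that do not lie on the path from the root to `t`. -/
def children (t : N) : Set N := {s | T.Adj t s ∧ ¬ IsAncestor T r s t}

/-- A leaf is a node without children. -/
def IsLeaf (t : N) : Prop := children T r t = ∅

end RootedTree

/-- A rooted superbranch decomposition of a hypergraph: a rooted tree in which every node that is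
not a leaf has at least two children, and a bijection from its leaves to the hyperedges. -/
structure SuperbranchDecomposition {V : Type u} {E : Type v} (X : MultiHypergraph V E)
    (N : Type w) where
  tree : SimpleGraph N
  root : N
  isTree : tree.IsTree
  two_children : ∀ t, ¬ IsLeaf tree root t → (children tree root t).Nontrivial
  leafEquiv : {t // IsLeaf tree root t} ≃ E

namespace SuperbranchDecomposition

variable {V : Type u} {E : Type v} {X : MultiHypergraph V E} {N : Type w}
  (D : SuperbranchDecomposition X N)

/-- The hyperedges that are assigned to the leaves below `t`. -/
def below (t : N) : Set E := {e | IsAncestor D.tree D.root t (D.leafEquiv.symm e)}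

/-- The adhesion at the edge between `t` and its parent, for a node `t` other than the root. -/
def adhesion (t : N) : Set V := X.bd (D.below t)

/-- All adhesions have size at most `α`. -/
def HasAdhesionSize (α : ℕ) : Prop := ∀ t, t ≠ D.root → (D.adhesion t).ncard ≤ α

/-- The sets of hyperedges below the nodes are all well-linked. -/
def DownwardsWellLinked : Prop := ∀ t, X.WellLinked (D.below t)

/-- The set of children of the root. -/
def rootChildren : Set N := children D.tree D.root D.root

/-- The torso of the root: it has one hyperedge for each neighbour of the root, that is, for each
child `s`, and the vertices of this hyperedge are those of the adhesion at `s`. -/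
def rootTorso : MultiHypergraph V D.rootChildren where
  inc s := D.adhesion s

/-- The hyperedges below the children of the root that correspond to the hyperedges `B` of the
torso of the root. -/
def expand (B : Set D.rootChildren) : Set E := {e | ∃ s ∈ B, e ∈ D.below s}

end SuperbranchDecomposition

end Mergeable

end

open Mergeable

/-! Let h be the number of vertices of H. Excluding H excludes a subdivision of the complete graph
on h vertices, and nothing else about H is used. As each `below s` is well-linked, any two vertices
of its boundary are joined through its interior, and the interiors for different children of the
root are disjoint. Pairwise disjoint connected sets attached to a vertex set Y can serve as edges on
Y, and a graph W on Y realised in this way has no subdivision of the complete graph either. By a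
Mader-type bound (`exists_isModel_of_degSum`) W is sparse. Hence the number of sets with at least h
attachments (`IsAttachedFamily.card_le_of_le_card`) and the number of different attachment sets
(`IsAttachedFamily.card_image_le`) are linear in |Y|.

Let X be the modulator. All but O(k) children have an interior disjoint from X and fewer than h
boundary vertices in X (`card_bad_le`); balanced separators of G - X then bound their adhesions
(`WellLinked.lam_le`). Let R consist of X and the adhesions of the other children. A tree
decomposition of G - X turns into one of the good torso hyperedges outside R, with bounded bags
(`exists_hyperDecomposition`). As in protrusion decompositions, the Erdős–Pósa property of subtrees
and closure under lowest common ancestors enlarge R by a constant factor to a set R₀ such that every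
class of hyperedges linked outside R₀ has boundedly many vertices in R₀
(`exists_small_attachments`).

Only O(|R₀|) attachment sets occur, so if the root has many children, many hyperedges share one of
them. A balanced cut of the tree isolates between n and 2n of these hyperedges by the attachment set
and one bag (`exists_small_boundary`). Finally the link classes inside this part have at most 2^γ
different boundaries; keeping the most frequent one makes all internal components have the same
boundary (`exists_uniform_subset`), and n = 2^(2γ+2) leaves enough hyperedges. -/

namespace Mergeable

/-! ### Average degree, subdivisions of complete graphs, and attached families -/

noncomputable section Dense

open scoped Classical

universe u v

/-- `x` and `y` are joined by a walk of `G` all of whose vertices lie in `S`. -/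
def ConnIn {V : Type u} (G : SimpleGraph V) (S : Set V) (x y : V) : Prop :=
  ∃ p : G.Walk x y, ∀ v ∈ p.support, v ∈ S

namespace ConnIn

variable {V : Type u} {G : SimpleGraph V} {S S' : Set V} {x y z : V}

theorem refl (hx : x ∈ S) : ConnIn G S x x :=
  ⟨SimpleGraph.Walk.nil, by simpa using hx⟩

theorem of_adj (h : G.Adj x y) (hx : x ∈ S) (hy : y ∈ S) : ConnIn G S x y :=
  ⟨h.toWalk, by simp [hx, hy]⟩

theorem symm (h : ConnIn G S x y) : ConnIn G S y x := by
  obtain ⟨p, hp⟩ := h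
  exact ⟨p.reverse, by simpa using hp⟩

theorem trans (h : ConnIn G S x y) (h' : ConnIn G S y z) : ConnIn G S x z := by
  obtain ⟨p, hp⟩ := h
  obtain ⟨q, hq⟩ := h'
  refine ⟨p.append q, fun v hv => ?_⟩
  rw [SimpleGraph.Walk.mem_support_append_iff] at hv
  exact hv.elim (hp v) (hq v)

theorem mono (hS : S ⊆ S') (h : ConnIn G S x y) : ConnIn G S' x y := by
  obtain ⟨p, hp⟩ := h
  exact ⟨p, fun v hv => hS (hp v hv)⟩

theorem left_mem (h : ConnIn G S x y) : x ∈ S := by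
  obtain ⟨p, hp⟩ := h
  exact hp _ p.start_mem_support

theorem right_mem (h : ConnIn G S x y) : y ∈ S := h.symm.left_mem

/-- A connection can be transported along a map of edges to connections. -/
theorem bind {W : SimpleGraph V} (h : ConnIn W S x y) (hx : x ∈ S')
    (H : ∀ a b, a ∈ S → b ∈ S → W.Adj a b → ConnIn G S' a b) : ConnIn G S' x y := by
  obtain ⟨p, hp⟩ := h
  induction p with
  | nil => exact refl hx
  | cons hadj q ih =>
    have h1 := H _ _ (hp _ (by simp)) (hp _ (by simp)) hadj
    exact h1.trans (ih h1.right_mem fun v hv => hp v (by simp [hv]))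

end ConnIn

variable {V : Type u} (G : SimpleGraph V)

/-- Twice the number of edges of `G` inside `A`. -/
def degSum (A : Finset V) : ℕ := ∑ x ∈ A, (A.filter (G.Adj x)).card

theorem degSum_erase {A : Finset V} {v : V} (hv : v ∈ A) :
    degSum G A = degSum G (A.erase v) + 2 * (A.filter (G.Adj v)).card := by
  obtain ⟨B, hB, rfl⟩ : ∃ B, v ∉ B ∧ A = insert v B :=
    ⟨A.erase v, Finset.notMem_erase v A, (Finset.insert_erase hv).symm⟩
  have h1 : ((insert v B).filter (G.Adj v)).card = ∑ y ∈ B, if G.Adj v y then 1 else 0 := by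
    rw [Finset.filter_insert, if_neg (G.loopless.irrefl v), Finset.card_filter]
  have h2 : ∀ x, ((insert v B).filter (G.Adj x)).card =
      (if G.Adj v x then 1 else 0) + (B.filter (G.Adj x)).card := by
    intro x
    rw [Finset.card_filter, Finset.card_filter, Finset.sum_insert hB, G.adj_comm]
  rw [Finset.erase_insert hB, degSum, Finset.sum_insert hB, h1]
  simp only [h2, Finset.sum_add_distrib, degSum]
  ring

/-- A graph of large average degree has a connected set `U` and a non-empty set `B` of neighbours
of `U` that induces a graph of at least half the average degree. -/
theorem exists_dense_neighborhood {D : ℕ} (hD : 0 < D) (A : Finset V) (hA : A.Nonempty)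
    (h : 2 * D * A.card ≤ degSum G A) :
    ∃ U B : Finset V, U ⊆ A ∧ (∀ x ∈ U, ∀ y ∈ U, ConnIn G U x y) ∧ B ⊆ A \ U ∧ B.Nonempty ∧
      (∀ v ∈ B, ∃ u ∈ U, G.Adj u v) ∧ D * B.card ≤ degSum G B := by
  induction hn : A.card using Nat.strong_induction_on generalizing A with
  | _ n ih =>
  subst hn
  set nb : Finset V → Finset V := fun U => (A \ U).filter fun v => ∃ u ∈ U, G.Adj u v with hnb
  -- `q U`: contracting the connected set U leaves a graph of average degree at least `2 * D`. The
  -- right-hand side is twice the number of edges of the contraction.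
  set q : Finset V → Prop := fun U => U ⊆ A ∧ U.Nonempty ∧
    (∀ x ∈ U, ∀ y ∈ U, ConnIn G U x y) ∧
    2 * D * ((A \ U).card + 1) ≤ degSum G (A \ U) + 2 * (nb U).card with hq
  obtain ⟨x, hx⟩ := hA
  have hqx : q {x} := by
    refine ⟨by simpa using hx, by simp, ?_, ?_⟩
    · intro a ha b hb
      rw [Finset.mem_singleton] at ha hb
      subst ha; subst hb
      exact ConnIn.refl (by simp)
    · have e1 : A \ {x} = A.erase x := Finset.sdiff_singleton_eq_erase x A
      have e2 : nb {x} = A.filter (G.Adj x) := by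
        ext v
        simp only [hnb, Finset.mem_filter, Finset.mem_sdiff, Finset.mem_singleton, exists_eq_left]
        exact ⟨fun h => ⟨h.1.1, h.2⟩, fun h => ⟨⟨h.1, h.2.ne'⟩, h.2⟩⟩
      rw [e2, e1, ← degSum_erase G hx, Finset.card_erase_add_one hx]
      exact h
  obtain ⟨U, hU, hmax⟩ : ∃ U, q U ∧ ∀ U', q U' → U'.card ≤ U.card := by
    have hfin : (A.powerset.filter q).Nonempty := ⟨{x}, by simp [hqx, hx]⟩
    obtain ⟨U, hU, hm⟩ := Finset.exists_max_image _ Finset.card hfin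
    refine ⟨U, (Finset.mem_filter.1 hU).2, fun U' hU' => hm U' ?_⟩
    exact Finset.mem_filter.2 ⟨Finset.mem_powerset.2 hU'.1, hU'⟩
  obtain ⟨hUA, hUne, hUc, hUq⟩ := hU
  by_cases hB : (nb U).Nonempty
  · refine ⟨U, nb U, hUA, hUc, Finset.filter_subset _ _, hB,
      fun v hv => (Finset.mem_filter.1 hv).2, ?_⟩
    -- Maximality of U: contracting v into U loses one vertex, the edge between v and U, and one
    -- edge per common neighbour. With fewer than D common neighbours the average degree would
    -- survive.
    have key : ∀ v ∈ nb U, D ≤ ((nb U).filter (G.Adj v)).card := by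
      intro v hv
      obtain ⟨hvA, u, huU, huv⟩ := Finset.mem_filter.1 hv
      have hvU : v ∉ U := (Finset.mem_sdiff.1 hvA).2
      by_contra hlt
      have hq' : q (insert v U) := by
        refine ⟨?_, by simp, ?_, ?_⟩
        · exact Finset.insert_subset (Finset.mem_sdiff.1 hvA).1 hUA
        · have hsub : (U : Set V) ⊆ ((insert v U : Finset V) : Set V) := by simp
          have hcu : ∀ a ∈ insert v U, ConnIn G ((insert v U : Finset V) : Set V) a u := by
            intro a ha
            rcases Finset.mem_insert.1 ha with rfl | ha
            · exact ConnIn.of_adj huv.symm (by simp) (by simp [huU])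
            · exact (hUc a ha u huU).mono hsub
          exact fun a ha b hb => (hcu a ha).trans (hcu b hb).symm
        · have e1 : A \ insert v U = (A \ U).erase v := by
            rw [Finset.sdiff_insert]
          have e2 : (nb (insert v U)).card + ((nb U).filter (G.Adj v)).card + 1 =
              (nb U).card + ((A \ U).filter (G.Adj v)).card := by
            have : nb (insert v U) = ((nb U) ∪ (A \ U).filter (G.Adj v)).erase v := by
              ext w
              simp only [hnb, Finset.mem_filter, Finset.mem_sdiff, Finset.mem_insert,
                Finset.mem_erase, Finset.mem_union, not_or, exists_eq_or_imp, ne_eq]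
              constructor
              · rintro ⟨⟨h1, h2, h3⟩, h4 | h4⟩
                · exact ⟨h2, Or.inr ⟨⟨h1, h3⟩, h4⟩⟩
                · exact ⟨h2, Or.inl ⟨⟨h1, h3⟩, h4⟩⟩
              · rintro ⟨h2, ⟨⟨h1, h3⟩, h4⟩ | ⟨⟨h1, h3⟩, h4⟩⟩
                · exact ⟨⟨h1, h2, h3⟩, Or.inr h4⟩
                · exact ⟨⟨h1, h2, h3⟩, Or.inl h4⟩
            rw [this]
            have e3 : (nb U ∩ (A \ U).filter (G.Adj v)) = (nb U).filter (G.Adj v) := by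
              ext w
              simp only [hnb, Finset.mem_filter, Finset.mem_inter]
              tauto
            have e4 := Finset.card_union_add_card_inter (nb U) ((A \ U).filter (G.Adj v))
            rw [e3] at e4
            rw [← e4, add_right_comm, Finset.card_erase_add_one]
            exact Finset.mem_union_left _ hv
          have e5 := degSum_erase G hvA
          have e6 := Finset.card_erase_add_one hvA
          rw [e1, e6]
          rw [e5] at hUq
          have : 2 * D * ((A \ U).card + 1) = 2 * D * (A \ U).card + 2 * D := by ring
          omega
      have := hmax _ hq'
      rw [Finset.card_insert_of_notMem hvU] at this
      omega
    calc D * (nb U).card = ∑ _v ∈ nb U, D := by simp [mul_comm]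
      _ ≤ _ := Finset.sum_le_sum key
  -- Now no edge leaves U inside A, so the smaller set `A \ U` carries all the density and induction
  -- applies.
  · rw [Finset.not_nonempty_iff_eq_empty] at hB
    rw [hB, Finset.card_empty, mul_zero, add_zero] at hUq
    have hne : (A \ U).Nonempty := by
      rw [Finset.nonempty_iff_ne_empty]
      intro h0
      rw [h0] at hUq
      simp [degSum] at hUq
      omega
    have hlt : (A \ U).card < A.card := by
      apply Finset.card_lt_card
      rw [Finset.ssubset_iff_of_subset Finset.sdiff_subset]
      obtain ⟨u, hu⟩ := hUne
      exact ⟨u, hUA hu, by simp [hu]⟩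
    obtain ⟨U', B, h1, h2, h3, h4⟩ := ih _ hlt (A \ U) hne
      (le_trans (Nat.mul_le_mul_left _ (Nat.le_succ _)) hUq) rfl
    exact ⟨U', B, h1.trans Finset.sdiff_subset, h2,
      h3.trans (Finset.sdiff_subset_sdiff Finset.sdiff_subset le_rfl), h4⟩

/-- Branch vertices `f` and pairwise disjoint sets `I e`, for the pairs `e ∈ S`, that connect the
branch vertices of the pair: a subdivision of the graph with edge set `S` inside `A`. -/
structure IsModel {r : ℕ} (A : Set V) (S : Set (Fin r × Fin r)) (f : Fin r → V)
    (I : Fin r × Fin r → Set V) : Prop where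
  injective : Function.Injective f
  branch_mem : ∀ a, f a ∈ A
  subset : ∀ e ∈ S, I e ⊆ A
  branch_notMem : ∀ e ∈ S, ∀ a, f a ∉ I e
  disjoint : ∀ e ∈ S, ∀ e' ∈ S, e ≠ e' → Disjoint (I e) (I e')
  conn : ∀ e ∈ S, ConnIn G (I e ∪ {f e.1, f e.2}) (f e.1) (f e.2)

/-- Large average degree forces a subdivision of any given graph on `r` vertices. -/
theorem exists_isModel_of_degSum {r : ℕ} (S : Finset (Fin r × Fin r)) (A : Finset V)
    (hA : A.Nonempty) (h : 2 * (2 ^ S.card * (r + 1)) * A.card ≤ degSum G A) :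
    ∃ f I, IsModel G (A : Set V) (S : Set (Fin r × Fin r)) f I := by
  induction S using Finset.induction_on generalizing A with
  | empty =>
    -- Without pairs, only r distinct vertices are needed; the factor `r + 1` in the density
    -- provides them, since degrees are at most |A|.
    have hr : r ≤ A.card := by
      by_contra hlt
      have : degSum G A ≤ A.card * A.card := by
        calc degSum G A ≤ ∑ _x ∈ A, A.card :=
              Finset.sum_le_sum fun x _ => Finset.card_filter_le _ _
          _ = _ := by simp
      have hpos := hA.card_pos
      simp only [Finset.card_empty, pow_zero, one_mul] at h
      have h3 := Nat.le_of_mul_le_mul_right (h.trans this) hpos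
      omega
    obtain ⟨g⟩ : Nonempty (Fin r ↪ A) := by
      rw [Function.Embedding.nonempty_iff_card_le]; simpa using hr
    refine ⟨fun a => g a, fun _ => ∅, ⟨fun a b hab => g.injective (Subtype.ext hab),
      fun a => (g a).2, ?_, ?_, ?_, ?_⟩⟩ <;> simp
  | insert e S he ih =>
    rw [Finset.card_insert_of_notMem he] at h
    -- U is reserved for the new pair: every vertex of B has a neighbour in U, so the ends can be
    -- joined through U wherever the induction places them in B. This costs half of the density per
    -- pair.
    obtain ⟨U, B, hUA, hUc, hBA, hB, hBU, hd⟩ := exists_dense_neighborhood G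
      (D := 2 * (2 ^ S.card * (r + 1))) (by positivity) A hA (by convert h using 2; ring)
    obtain ⟨f, I, hm⟩ := ih B hB hd
    have hBU' : ∀ x, x ∈ B → x ∉ U := fun x hx => (Finset.mem_sdiff.1 (hBA hx)).2
    have hne : ∀ e' ∈ S, e' ≠ e := fun e' he' h => he (h ▸ he')
    have hdis : ∀ e' ∈ S, Disjoint (I e') (U : Set V) := fun e' he' =>
      Set.disjoint_left.2 fun x hx hxU => hBU' x (hm.subset e' he' hx) hxU
    refine ⟨f, Function.update I e (U : Set V), ⟨hm.injective,
      fun a => (Finset.mem_sdiff.1 (hBA (hm.branch_mem a))).1, ?_, ?_, ?_, ?_⟩⟩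
    · intro e' he'
      rcases Finset.mem_insert.1 he' with rfl | he'
      · simpa using hUA
      · rw [Function.update_of_ne (hne e' he')]
        exact fun x hx => (Finset.mem_sdiff.1 (hBA (hm.subset e' he' hx))).1
    · intro e' he' a
      rcases Finset.mem_insert.1 he' with rfl | he'
      · simpa using hBU' _ (hm.branch_mem a)
      · rw [Function.update_of_ne (hne e' he')]
        exact hm.branch_notMem e' he' a
    · intro e₁ h₁ e₂ h₂ h₁₂
      rcases Finset.mem_insert.1 h₁ with h₁ | h₁ <;>
        rcases Finset.mem_insert.1 h₂ with h₂ | h₂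
      · exact absurd (h₁.trans h₂.symm) h₁₂
      · rw [h₁, Function.update_self, Function.update_of_ne (hne e₂ h₂)]
        exact (hdis e₂ h₂).symm
      · rw [h₂, Function.update_self, Function.update_of_ne (hne e₁ h₁)]
        exact hdis e₁ h₁
      · rw [Function.update_of_ne (hne e₁ h₁), Function.update_of_ne (hne e₂ h₂)]
        exact hm.disjoint e₁ h₁ e₂ h₂ h₁₂
    · intro e' he'
      rcases Finset.mem_insert.1 he' with rfl | he'
      · rw [Function.update_self]
        obtain ⟨u, hu, hua⟩ := hBU _ (hm.branch_mem e'.1)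
        obtain ⟨w, hw, hwb⟩ := hBU _ (hm.branch_mem e'.2)
        exact ((ConnIn.of_adj hua.symm (by simp) (by simp [hu])).trans
          ((hUc u hu w hw).mono Set.subset_union_left)).trans
          (ConnIn.of_adj hwb (by simp [hw]) (by simp))
      · rw [Function.update_of_ne (hne e' he')]
        exact hm.conn e' he'

/-- The pairs `a < b`: the edges of the complete graph. -/
def ltPairs (r : ℕ) : Finset (Fin r × Fin r) := Finset.univ.filter fun e => e.1 < e.2

theorem mem_ltPairs {r : ℕ} {e : Fin r × Fin r} : e ∈ ltPairs r ↔ e.1 < e.2 := by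
  simp [ltPairs]

/-- `G` has a subdivision of the complete graph on `r` vertices. -/
def HasCliqueModel (r : ℕ) : Prop :=
  ∃ f I, IsModel G Set.univ (ltPairs r : Set (Fin r × Fin r)) f I

/-- Half of an average degree that forces a subdivision of the complete graph on `r` vertices. -/
def maderBound (r : ℕ) : ℕ := 2 ^ (r * r) * (r + 1)

/-- A complete graph contains every graph on its vertex set, so superfluous paths are ignored. Only
pairs a < b have a chosen path; the other direction is its reverse. -/
theorem HasCliqueModel.isTopologicalMinor {r : ℕ} (hG : HasCliqueModel G r)
    (H : SimpleGraph (Fin r)) : IsTopologicalMinor H G := by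
  obtain ⟨f, I, hm⟩ := hG
  have hp : ∀ a b : Fin r, a < b → ∃ p : G.Walk (f a) (f b), p.IsPath ∧
      ∀ v ∈ p.support, v ∈ I (a, b) ∪ {f a, f b} := by
    intro a b hab
    obtain ⟨p, hp⟩ := hm.conn (a, b) (by simpa [mem_ltPairs] using hab)
    exact ⟨p.bypass, p.bypass_isPath, fun v hv => hp v (p.support_bypass_subset_support hv)⟩
  choose p hpath hsupp using hp
  refine ⟨⟨f, hm.injective⟩, fun a b hab => if h : a < b then p a b h else
    (p b a (lt_of_le_of_ne (not_lt.1 h) hab.ne')).reverse, ?_, ?_, ?_, ?_⟩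
  · intro a b hab
    dsimp only
    split_ifs with h
    · exact hpath _ _ _
    · exact (hpath _ _ _).reverse
  · intro a b hab
    dsimp only
    rcases lt_or_gt_of_ne hab.ne with h | h
    · rw [dif_pos h, dif_neg (not_lt.2 h.le)]
    · rw [dif_pos h, dif_neg (not_lt.2 h.le), SimpleGraph.Walk.reverse_reverse]
  all_goals
    have hs : ∀ a b (hab : H.Adj a b) y, y ∈ (if h : a < b then p a b h else
        (p b a (lt_of_le_of_ne (not_lt.1 h) hab.ne')).reverse).support →
        ∃ e : Fin r × Fin r, e.1 < e.2 ∧ s(e.1, e.2) = s(a, b) ∧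
          (y ∈ I e ∨ y = f a ∨ y = f b) := by
      intro a b hab y hy
      split_ifs at hy with h
      · exact ⟨(a, b), h, rfl, hsupp _ _ _ y hy⟩
      · rw [SimpleGraph.Walk.support_reverse, List.mem_reverse] at hy
        refine ⟨(b, a), lt_of_le_of_ne (not_lt.1 h) hab.ne', Sym2.eq_swap, ?_⟩
        have := hsupp _ _ _ y hy
        simp only [Set.mem_union, Set.mem_insert_iff, Set.mem_singleton_iff] at this
        tauto
  · intro a b hab x hx
    obtain ⟨e, he, -, h⟩ := hs a b hab _ hx
    rcases h with h | h | h
    · exact absurd h (hm.branch_notMem e (by simpa [mem_ltPairs] using he) x)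
    · exact Or.inl (hm.injective h)
    · exact Or.inr (hm.injective h)
  · intro a b hab a' b' hab' hne y hy hy'
    obtain ⟨e, he, hes, h⟩ := hs a b hab _ hy
    obtain ⟨e', he', hes', h'⟩ := hs a' b' hab' _ hy'
    rcases h with h | h | h
    · rcases h' with h' | h' | h'
      · have hee : e ≠ e' := by
          rintro rfl
          exact hne (hes.symm.trans hes')
        exact absurd h' (Set.disjoint_left.1 (hm.disjoint e (by simpa [mem_ltPairs] using he) e'
          (by simpa [mem_ltPairs] using he') hee) h)
      · exact ⟨a', h'.symm⟩
      · exact ⟨b', h'.symm⟩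
    · exact ⟨a, h.symm⟩
    · exact ⟨b, h.symm⟩

/-! ### Families of attached connected sets -/

/-- The vertex sets of the cliques of `G` inside `Y`. -/
def cliquesIn (Y : Finset V) : Finset (Finset V) := Y.powerset.filter fun C => G.IsClique C

/-- Remove a vertex v of degree at most d: a clique through v is v together with some of its
neighbours, so at most `2 ^ d` cliques are lost. The summand 1 counts the empty clique. -/
theorem card_cliquesIn_le {d : ℕ} (Y : Finset V)
    (h : ∀ A ⊆ Y, A.Nonempty → ∃ v ∈ A, (A.filter (G.Adj v)).card ≤ d) :
    (cliquesIn G Y).card ≤ 2 ^ d * Y.card + 1 := by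
  induction hn : Y.card generalizing Y with
  | zero =>
    rw [Finset.card_eq_zero] at hn
    subst hn
    refine (Finset.card_filter_le _ _).trans ?_
    simp
  | succ n ih =>
    have hY : Y.Nonempty := Finset.card_pos.1 (by omega)
    obtain ⟨v, hv, hd⟩ := h Y le_rfl hY
    have hc := ih (Y.erase v) (fun A hA => h A (hA.trans (Finset.erase_subset _ _)))
      (by rw [Finset.card_erase_of_mem hv]; omega)
    have hsub : cliquesIn G Y ⊆ cliquesIn G (Y.erase v) ∪
        (Y.filter (G.Adj v)).powerset.image (insert v) := by
      intro C hC
      obtain ⟨hCY, hCc⟩ := Finset.mem_filter.1 hC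
      rw [Finset.mem_powerset] at hCY
      by_cases hvC : v ∈ C
      · refine Finset.mem_union_right _ (Finset.mem_image.2 ⟨C.erase v, ?_,
          Finset.insert_erase hvC⟩)
        rw [Finset.mem_powerset]
        intro w hw
        obtain ⟨hwv, hwC⟩ := Finset.mem_erase.1 hw
        exact Finset.mem_filter.2 ⟨hCY hwC, hCc hvC hwC hwv.symm⟩
      · refine Finset.mem_union_left _ (Finset.mem_filter.2 ⟨?_, hCc⟩)
        rw [Finset.mem_powerset]
        exact fun w hw => Finset.mem_erase.2 ⟨fun h => hvC (h ▸ hw), hCY hw⟩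
    calc (cliquesIn G Y).card ≤ _ := Finset.card_le_card hsub
      _ ≤ _ := Finset.card_union_le _ _
      _ ≤ (2 ^ d * n + 1) + 2 ^ d := by
        refine Nat.add_le_add hc (Finset.card_image_le.trans ?_)
        rw [Finset.card_powerset]
        exact Nat.pow_le_pow_right (by norm_num) hd
      _ = _ := by ring

variable {ι : Type v}

/-- Pairwise disjoint connected sets `Q j` outside `Y` that are attached to the sets
`nb j ⊆ Y`. -/
structure IsAttachedFamily (Y : Finset V) (nb : ι → Finset V) (Q : ι → Set V) : Prop where
  subset : ∀ j, nb j ⊆ Y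
  disjoint : ∀ j j', j ≠ j' → Disjoint (Q j) (Q j')
  notMem : ∀ j, ∀ y ∈ Y, y ∉ Q j
  conn : ∀ j, ∀ x ∈ nb j, ∀ y ∈ nb j, x ≠ y → ConnIn G (Q j ∪ {x, y}) x y

variable {G}

/-- If the edges of a graph `W` on `Y` can be assigned to distinct members of an attached family,
then a clique model of `W` yields one of `G`. -/
theorem IsAttachedFamily.hasCliqueModel {Y : Finset V} {nb : ι → Finset V} {Q : ι → Set V}
    (hF : IsAttachedFamily G Y nb Q) {W : SimpleGraph V} (φ : Sym2 V → ι)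
    (hφ : ∀ e ∈ W.edgeSet, ∀ e' ∈ W.edgeSet, φ e = φ e' → e = e')
    (hmem : ∀ x y, W.Adj x y → x ∈ nb (φ s(x, y)) ∧ y ∈ nb (φ s(x, y)))
    {r : ℕ} {f : Fin r → V} {I : Fin r × Fin r → Set V}
    (hm : IsModel W (Y : Set V) (ltPairs r : Set (Fin r × Fin r)) f I) : HasCliqueModel G r := by
  set K : Fin r × Fin r → Set V := fun e => I e ∪ {f e.1, f e.2} with hK
  -- Each edge of W inside a subdivided edge `K e` becomes a detour through the member assigned to
  -- it.
  set I' : Fin r × Fin r → Set V := fun e => I e ∪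
    {v | ∃ x y, W.Adj x y ∧ x ∈ K e ∧ y ∈ K e ∧ v ∈ Q (φ s(x, y))} with hI'
  refine ⟨f, I', hm.injective, fun _ => trivial, fun _ _ _ _ => trivial, ?_, ?_, ?_⟩
  · rintro e he a (ha | ⟨x, y, -, -, -, ha⟩)
    · exact hm.branch_notMem e he a ha
    · exact hF.notMem _ _ (hm.branch_mem a) ha
  · intro e he e' he' hee
    rw [Set.disjoint_left]
    rintro v (hv | ⟨x, y, hxy, hx, hy, hv⟩) (hv' | ⟨x', y', hxy', hx', hy', hv'⟩)
    · exact Set.disjoint_left.1 (hm.disjoint e he e' he' hee) hv hv'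
    · exact hF.notMem _ v (hm.subset e he hv) hv'
    · exact hF.notMem _ v (hm.subset e' he' hv') hv
    -- Distinct pairs cannot use the same edge of W: both of its ends would be branch vertices
    -- common to the two pairs, which determine the pair.
    · have hφe : φ s(x, y) = φ s(x', y') := by
        by_contra hne
        exact Set.disjoint_left.1 (hF.disjoint _ _ hne) hv hv'
      have hs := hφ _ hxy _ hxy' hφe
      have hx2 : x ∈ K e' ∧ y ∈ K e' := by
        rcases Sym2.eq_iff.1 hs with ⟨rfl, rfl⟩ | ⟨rfl, rfl⟩
        · exact ⟨hx', hy'⟩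
        · exact ⟨hy', hx'⟩
      have hbr : ∀ z, z ∈ K e → z ∈ K e' → ∃ a, z = f a ∧ (a = e.1 ∨ a = e.2) ∧
          (a = e'.1 ∨ a = e'.2) := by
        rintro z (hz | hz) (hz' | hz')
        · exact absurd hz' (Set.disjoint_left.1 (hm.disjoint e he e' he' hee) hz)
        · rcases hz' with rfl | rfl
          · exact absurd hz (hm.branch_notMem e he _)
          · exact absurd hz (hm.branch_notMem e he _)
        · rcases hz with rfl | rfl
          · exact absurd hz' (hm.branch_notMem e' he' _)
          · exact absurd hz' (hm.branch_notMem e' he' _)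
        · have h1 : ∃ a, z = f a ∧ (a = e.1 ∨ a = e.2) := by
            rcases hz with rfl | rfl
            · exact ⟨_, rfl, Or.inl rfl⟩
            · exact ⟨_, rfl, Or.inr rfl⟩
          obtain ⟨a, rfl, ha⟩ := h1
          refine ⟨a, rfl, ha, ?_⟩
          rcases hz' with h | h
          · exact Or.inl (hm.injective h)
          · exact Or.inr (hm.injective h)
      obtain ⟨a, rfl, ha, ha'⟩ := hbr x hx hx2.1
      obtain ⟨b, rfl, hb, hb'⟩ := hbr y hy hx2.2
      have hab : a ≠ b := fun h => hxy.ne (congrArg f h)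
      have l1 : e.1 < e.2 := by simpa [mem_ltPairs] using he
      have l2 : e'.1 < e'.2 := by simpa [mem_ltPairs] using he'
      apply hee
      rcases ha with rfl | rfl <;> rcases hb with rfl | rfl <;>
        rcases ha' with ha' | ha' <;> rcases hb' with hb' | hb' <;>
        first
        | exact absurd rfl hab
        | exact absurd (ha'.trans hb'.symm) hab
        | exact Prod.ext ha' hb'
        | exact Prod.ext hb' ha'
        | exact absurd (ha' ▸ hb' ▸ l1) (not_lt.2 l2.le)
  · intro e he
    refine (hm.conn e he).bind (Or.inr (by simp)) fun a b ha hb hab => ?_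
    obtain ⟨h1, h2⟩ := hmem a b hab
    have hsub : ∀ z, z ∈ K e → z ∈ I' e ∪ {f e.1, f e.2} := by
      rintro z (hz | hz)
      · exact Or.inl (Or.inl hz)
      · exact Or.inr hz
    refine (hF.conn _ a h1 b h2 hab.ne).mono ?_
    rintro z (hz | rfl | rfl)
    · exact Or.inl (Or.inr ⟨a, b, hab, ha, hb, hz⟩)
    · exact hsub _ ha
    · exact hsub _ hb

theorem card_ltPairs_le (r : ℕ) : (ltPairs r).card ≤ r * r :=
  (Finset.card_filter_le _ _).trans (by simp)

theorem degSum_lt_of_not_isModel {r : ℕ} {A : Finset V} (hA : A.Nonempty)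
    (h : ¬ ∃ f I, IsModel G (A : Set V) (ltPairs r : Set (Fin r × Fin r)) f I) :
    degSum G A < 2 * maderBound r * A.card := by
  by_contra hlt
  refine h (exists_isModel_of_degSum G (ltPairs r) A hA (le_trans ?_ (not_lt.1 hlt)))
  refine Nat.mul_le_mul_right _ (Nat.mul_le_mul_left _ (Nat.mul_le_mul_right _ ?_))
  exact Nat.pow_le_pow_right (by norm_num) (card_ltPairs_le r)

theorem IsModel.mono {A A' : Set V} {r : ℕ} {S : Set (Fin r × Fin r)} {f : Fin r → V}
    {I : Fin r × Fin r → Set V} (h : IsModel G A S f I) (hA : A ⊆ A') : IsModel G A' S f I :=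
  ⟨h.injective, fun a => hA (h.branch_mem a), fun e he => (h.subset e he).trans hA,
    h.branch_notMem, h.disjoint, h.conn⟩

/-- The sets of an attached family give rise to a sparse graph on `Y` such that all but few of the
sets `nb j` are cliques. -/
theorem IsAttachedFamily.exists_graph [Finite V] {Y : Finset V} {nb : ι → Finset V}
    {Q : ι → Set V} (hF : IsAttachedFamily G Y nb Q) {r : ℕ} (hG : ¬ HasCliqueModel G r) :
    ∃ (W : SimpleGraph V) (J : Finset ι), J.card ≤ maderBound r * Y.card ∧
      (∀ j ∉ J, W.IsClique (nb j)) ∧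
      ¬ ∃ f I, IsModel W (Y : Set V) (ltPairs r : Set (Fin r × Fin r)) f I := by
  have := Fintype.ofFinite V
  rcases isEmpty_or_nonempty ι with hι | ⟨⟨j₀⟩⟩
  · refine ⟨⊥, ∅, by simp, fun j => hι.elim j, fun ⟨f, I, hm⟩ => hG ?_⟩
    refine ⟨f, I, hm.injective, fun _ => trivial, fun _ _ _ _ => trivial, hm.branch_notMem,
      hm.disjoint, fun e he => (hm.conn e he).bind (Or.inr (by simp)) ?_⟩
    exact fun _ _ _ _ h => h.elim
  -- Sets of vertex pairs with distinct representatives among the members. A largest such set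
  -- becomes the edge set of W, and the members used become J.
  set valid : Finset (Sym2 V) → (Sym2 V → ι) → Prop := fun E φ =>
    (∀ e ∈ E, ¬ e.IsDiag ∧ ∀ x ∈ e, x ∈ nb (φ e)) ∧
      ∀ e ∈ E, ∀ e' ∈ E, φ e = φ e' → e = e' with hvalid
  obtain ⟨E, ⟨φ, hφ⟩, hmax⟩ : ∃ E, (∃ φ, valid E φ) ∧ ∀ E', (∃ φ, valid E' φ) →
      E'.card ≤ E.card := by
    have hne : ((Finset.univ : Finset (Finset (Sym2 V))).filter fun E => ∃ φ, valid E φ).Nonempty :=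
      ⟨∅, by simpa using ⟨fun _ => j₀, by simp [hvalid]⟩⟩
    obtain ⟨E, hE, hm⟩ := Finset.exists_max_image _ Finset.card hne
    exact ⟨E, (Finset.mem_filter.1 hE).2, fun E' hE' =>
      hm E' (Finset.mem_filter.2 ⟨Finset.mem_univ _, hE'⟩)⟩
  obtain ⟨W, hW⟩ : ∃ W, W = SimpleGraph.fromEdgeSet (E : Set (Sym2 V)) := ⟨_, rfl⟩
  have hWE : ∀ x y, W.Adj x y → s(x, y) ∈ E := fun x y h => by
    rw [hW] at h
    simpa using (SimpleGraph.fromEdgeSet_adj _).1 h |>.1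
  have hWE' : W.edgeSet = (E : Set (Sym2 V)) := by
    rw [hW, SimpleGraph.edgeSet_fromEdgeSet]
    ext e
    exact ⟨fun h => h.1, fun h => ⟨h, (hφ.1 e h).1⟩⟩
  have hmem : ∀ x y, W.Adj x y → x ∈ nb (φ s(x, y)) ∧ y ∈ nb (φ s(x, y)) := fun x y h =>
    ⟨(hφ.1 _ (hWE x y h)).2 x (by simp), (hφ.1 _ (hWE x y h)).2 y (by simp)⟩
  have hno : ¬ ∃ f I, IsModel W (Y : Set V) (ltPairs r : Set (Fin r × Fin r)) f I := by
    rintro ⟨f, I, hm⟩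
    refine hG (hF.hasCliqueModel φ ?_ hmem hm)
    rw [hWE']
    exact hφ.2
  refine ⟨W, E.image φ, Finset.card_image_le.trans ?_, ?_, hno⟩
  · have hsum : degSum W Y = 2 * E.card := by
      have h1 := W.sum_degrees_eq_twice_card_edges
      have h2 : ∑ x, W.degree x = 2 * E.card := by
        rw [h1]
        congr 2
        ext e
        rw [SimpleGraph.mem_edgeFinset, hWE', Finset.mem_coe]
      rw [← h2, degSum, ← Finset.sum_subset (Finset.subset_univ Y)]
      · refine Finset.sum_congr rfl fun x _ => ?_
        rw [← SimpleGraph.card_neighborFinset_eq_degree]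
        congr 1
        ext y
        simp only [Finset.mem_filter, SimpleGraph.mem_neighborFinset, and_iff_right_iff_imp]
        exact fun h => hF.subset _ (hmem x y h).2
      · intro x _ hx
        rw [← SimpleGraph.card_neighborFinset_eq_degree, Finset.card_eq_zero,
          Finset.eq_empty_iff_forall_notMem]
        intro y hy
        exact hx (hF.subset _ (hmem x y ((W.mem_neighborFinset x y).1 hy)).1)
    rcases Y.eq_empty_or_nonempty with rfl | hY
    · have : degSum W ∅ = 0 := by simp [degSum]
      omega
    · have := degSum_lt_of_not_isModel hY hno
      rw [hsum] at this
      nlinarith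
  -- An unused member j could represent a missing pair inside `nb j`, against maximality.
  · intro j hj x hx y hy hxy
    by_contra hadj
    have hsE : s(x, y) ∉ E := fun h => hadj <| by
      rw [hW, SimpleGraph.fromEdgeSet_adj]
      exact ⟨h, hxy⟩
    have hne : ∀ e ∈ E, e ≠ s(x, y) := fun e he h => hsE (h ▸ he)
    have hne' : ∀ e ∈ E, φ e ≠ j := fun e he h => hj (Finset.mem_image.2 ⟨e, he, h⟩)
    have hv : valid (insert s(x, y) E) (Function.update φ s(x, y) j) := by
      constructor
      · intro e he
        rcases Finset.mem_insert.1 he with rfl | he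
        · rw [Function.update_self]
          refine ⟨by simpa using hxy, fun z hz => ?_⟩
          rcases Sym2.mem_iff.1 hz with rfl | rfl
          · exact hx
          · exact hy
        · rw [Function.update_of_ne (hne e he)]
          exact hφ.1 e he
      · intro e he e' he' hee
        rcases Finset.mem_insert.1 he with h | h <;> rcases Finset.mem_insert.1 he' with h' | h'
        · rw [h, h']
        · rw [h, Function.update_self, Function.update_of_ne (hne e' h')] at hee
          exact absurd hee.symm (hne' e' h')
        · rw [h', Function.update_self, Function.update_of_ne (hne e h)] at hee
          exact absurd hee (hne' e h)
        · rw [Function.update_of_ne (hne e h), Function.update_of_ne (hne e' h')] at hee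
          exact hφ.2 e h e' h' hee
    have := hmax _ ⟨_, hv⟩
    rw [Finset.card_insert_of_notMem hsE] at this
    omega

/-- Few sets of an attached family have many attachments. -/
theorem IsAttachedFamily.card_le_of_le_card [Finite V] {Y : Finset V} {nb : ι → Finset V}
    {Q : ι → Set V} (hF : IsAttachedFamily G Y nb Q) {r : ℕ} (hG : ¬ HasCliqueModel G r)
    (K : Finset ι) (hK : ∀ j ∈ K, r ≤ (nb j).card) : K.card ≤ maderBound r * Y.card := by
  obtain ⟨W, J, hJ, hcl, hno⟩ := hF.exists_graph hG
  -- Outside J, `nb j` is a clique of W on at least r vertices, which is already a model.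
  refine (Finset.card_le_card fun j hj => ?_).trans hJ
  by_contra hjJ
  obtain ⟨g⟩ : Nonempty (Fin r ↪ nb j) := by
    rw [Function.Embedding.nonempty_iff_card_le]; simpa using hK j hj
  refine hno ⟨fun a => g a, fun _ => ∅, ⟨fun a b hab => g.injective (Subtype.ext hab),
    fun a => hF.subset j (g a).2, by simp, by simp, by simp, fun e he => ?_⟩⟩
  have hne : (g e.1 : V) ≠ g e.2 := fun h => by
    have h1 : e.1 < e.2 := by simpa [mem_ltPairs] using he
    exact h1.ne (g.injective (Subtype.ext h))
  exact ConnIn.of_adj (hcl j hjJ (g e.1).2 (g e.2).2 hne) (by simp) (by simp)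

/-- An attached family has few different attachment sets. -/
theorem IsAttachedFamily.card_image_le [Finite V] {Y : Finset V} {nb : ι → Finset V}
    {Q : ι → Set V} (hF : IsAttachedFamily G Y nb Q) {r : ℕ} (hG : ¬ HasCliqueModel G r)
    (K : Finset ι) :
    (K.image nb).card ≤ (maderBound r + 2 ^ (2 * maderBound r)) * Y.card + 1 := by
  obtain ⟨W, J, hJ, hcl, hno⟩ := hF.exists_graph hG
  have hsub : K.image nb ⊆ J.image nb ∪ cliquesIn W Y := by
    intro S hS
    obtain ⟨j, -, rfl⟩ := Finset.mem_image.1 hS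
    by_cases hj : j ∈ J
    · exact Finset.mem_union_left _ (Finset.mem_image_of_mem _ hj)
    · exact Finset.mem_union_right _
        (Finset.mem_filter.2 ⟨Finset.mem_powerset.2 (hF.subset j), hcl j hj⟩)
  -- W is degenerate, because the exclusion of the clique model passes to subsets of Y.
  have hdeg : ∀ A ⊆ Y, A.Nonempty → ∃ v ∈ A, (A.filter (W.Adj v)).card ≤ 2 * maderBound r := by
    intro A hAY hA
    by_contra! hlt
    have h1 := degSum_lt_of_not_isModel (G := W) (r := r) hA
      fun ⟨f, I, hm⟩ => hno ⟨f, I, hm.mono hAY⟩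
    have h2 : A.card * (2 * maderBound r) ≤ degSum W A := by
      rw [← smul_eq_mul]
      exact Finset.card_nsmul_le_sum _ _ _ fun v hv => (hlt v hv).le
    rw [mul_comm] at h2
    omega
  calc (K.image nb).card ≤ _ := Finset.card_le_card hsub
    _ ≤ _ := Finset.card_union_le _ _
    _ ≤ maderBound r * Y.card + (2 ^ (2 * maderBound r) * Y.card + 1) :=
      Nat.add_le_add (Finset.card_image_le.trans hJ) (card_cliquesIn_le W Y hdeg)
    _ = _ := by ring

end Dense

end Mergeable

namespace Mergeable

/-! ### Subtrees of rooted forests: Helly, Erdős–Pósa, meets and balanced splits -/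

section TreeOrder

open scoped Classical

universe u v

variable {N : Type u} [PartialOrder N]

variable (N) in
/-- The order of a rooted forest: the elements below a given element form a chain. -/
def IsForestOrder : Prop := ∀ a b x : N, a ≤ x → b ≤ x → a ≤ b ∨ b ≤ a

/-- A connected set of nodes: it has a least element, and with each element it contains all nodes
between this element and the least one. -/
def IsSubtree (F : Set N) : Prop :=
  ∃ τ ∈ F, ∀ i ∈ F, τ ≤ i ∧ ∀ j, τ ≤ j → j ≤ i → j ∈ F

theorem IsSubtree.mem_of_le_of_le {F : Set N} (hF : IsSubtree F) {i j k : N} (hi : i ∈ F)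
    (hk : k ∈ F) (hij : i ≤ j) (hjk : j ≤ k) : j ∈ F := by
  obtain ⟨τ, -, h⟩ := hF
  exact (h k hk).2 j ((h i hi).1.trans hij) hjk

variable (hN : IsForestOrder N)
include hN

/-- The two roots both lie below a common node, so they are comparable, and the smaller one is the
root of the union. -/
theorem IsSubtree.union {F F' : Set N} (hF : IsSubtree F) (hF' : IsSubtree F')
    (h : (F ∩ F').Nonempty) : IsSubtree (F ∪ F') := by
  have key : ∀ (A B : Set N) (τ τ' c : N), c ∈ A → c ∈ B → τ ∈ A → τ ≤ τ' →
      (∀ i ∈ A, τ ≤ i ∧ ∀ j, τ ≤ j → j ≤ i → j ∈ A) →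
      (∀ i ∈ B, τ' ≤ i ∧ ∀ j, τ' ≤ j → j ≤ i → j ∈ B) → IsSubtree (A ∪ B) := by
    intro A B τ τ' c hcA hcB hτ hle hA hB
    refine ⟨τ, Or.inl hτ, ?_⟩
    rintro i (hi | hi)
    · exact ⟨(hA i hi).1, fun j h1 h2 => Or.inl ((hA i hi).2 j h1 h2)⟩
    · refine ⟨hle.trans (hB i hi).1, fun j h1 h2 => ?_⟩
      rcases hN _ _ _ h2 (hB i hi).1 with h3 | h3
      · exact Or.inl ((hA c hcA).2 j h1 (h3.trans (hB c hcB).1))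
      · exact Or.inr ((hB i hi).2 j h3 h2)
  obtain ⟨τ, hτ, h1⟩ := hF
  obtain ⟨τ', hτ', h2⟩ := hF'
  obtain ⟨c, hc, hc'⟩ := h
  rcases hN _ _ _ (h1 c hc).1 (h2 c hc').1 with hle | hle
  · exact key F F' τ τ' c hc hc' hτ hle h1 h2
  · rw [Set.union_comm]
    exact key F' F τ' τ c hc' hc hτ' hle h2 h1

theorem IsSubtree.biUnion_of_mem [Finite N] {ι : Type v} {F : ι → Set N} {s : Set ι}
    (hs : s.Nonempty) (hF : ∀ i ∈ s, IsSubtree (F i)) (c : N) (hc : ∀ i ∈ s, c ∈ F i) :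
    IsSubtree (⋃ i ∈ s, F i) := by
  have : Nonempty N := ⟨c⟩
  choose! τ hτ h using hF
  obtain ⟨m, hm⟩ := (Set.toFinite (τ '' s)).exists_minimal (hs.image τ)
  obtain ⟨⟨i₀, hi₀, rfl⟩, hmin⟩ := hm
  have hle : ∀ i ∈ s, τ i₀ ≤ τ i := by
    intro i hi
    rcases hN _ _ c (h i hi c (hc i hi)).1 (h i₀ hi₀ c (hc i₀ hi₀)).1 with hle | hle
    · exact hmin ⟨i, hi, rfl⟩ hle
    · exact hle
  refine ⟨τ i₀, Set.mem_biUnion hi₀ (hτ i₀ hi₀), ?_⟩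
  intro x hx
  obtain ⟨i, hi, hxi⟩ := Set.mem_iUnion₂.1 hx
  refine ⟨(hle i hi).trans (h i hi x hxi).1, fun j h1 h2 => ?_⟩
  rcases hN _ _ x h2 (h i hi x hxi).1 with h3 | h3
  · exact Set.mem_biUnion hi₀ ((h i₀ hi₀ c (hc i₀ hi₀)).2 j h1 (h3.trans (h i hi c (hc i hi)).1))
  · exact Set.mem_biUnion hi ((h i hi x hxi).2 j h3 h2)

/-- The union of a family of subtrees that is connected by intersections is a subtree. -/
theorem IsSubtree.biUnion_of_linked [Finite N] {ι : Type v} {F : ι → Set N} {s : Set ι}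
    (hF : ∀ i ∈ s, IsSubtree (F i)) (i₀ : ι) (hi₀ : i₀ ∈ s)
    (hl : ∀ i ∈ s, Relation.ReflTransGen (fun a b => b ∈ s ∧ (F a ∩ F b).Nonempty) i₀ i) :
    IsSubtree (⋃ i ∈ s, F i) := by
  -- Each member is joined to `F i₀` by a subtree inside the union. All these subtrees contain `F
  -- i₀`, so they share a node and `IsSubtree.biUnion_of_mem` applies.
  have key : ∀ i, Relation.ReflTransGen (fun a b => b ∈ s ∧ (F a ∩ F b).Nonempty) i₀ i →
      ∃ K : Set N, IsSubtree K ∧ K ⊆ (⋃ i ∈ s, F i) ∧ F i₀ ⊆ K ∧ F i ⊆ K := by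
    intro i hi
    induction hi with
    | refl => exact ⟨F i₀, hF _ hi₀, Set.subset_biUnion_of_mem hi₀, le_rfl, le_rfl⟩
    | @tail b c _ hbc ih =>
      obtain ⟨K, hK, hKs, h0, hb⟩ := ih
      refine ⟨K ∪ F c, hK.union hN (hF c hbc.1) ?_, Set.union_subset hKs
        (Set.subset_biUnion_of_mem hbc.1), h0.trans Set.subset_union_left,
        Set.subset_union_right⟩
      exact hbc.2.mono (Set.inter_subset_inter_left _ hb)
  choose! K hK hKs h0 hi using fun i (his : i ∈ s) => key i (hl i his)
  have heq : (⋃ i ∈ s, F i) = ⋃ i ∈ s, K i := by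
    apply Set.Subset.antisymm
    · exact Set.iUnion₂_mono fun i his => hi i his
    · exact Set.iUnion₂_subset fun i his => hKs i his
  obtain ⟨c, hc, -⟩ := hF i₀ hi₀
  rw [heq]
  exact IsSubtree.biUnion_of_mem hN ⟨i₀, hi₀⟩ hK c fun i his => h0 i his hc

/-- The Helly property of subtrees. -/
theorem exists_mem_of_pairwise_inter [Finite N] {ι : Type v} {F : ι → Set N} {s : Set ι}
    (hs : s.Nonempty) (hF : ∀ i ∈ s, IsSubtree (F i))
    (hpair : ∀ i ∈ s, ∀ j ∈ s, (F i ∩ F j).Nonempty) : ∃ t, ∀ i ∈ s, t ∈ F i := by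
  have : Nonempty N := by
    obtain ⟨i, hi⟩ := hs
    exact ⟨(hF i hi).choose⟩
  choose! τ hτ h using hF
  -- A maximal root lies in every subtree that meets its own subtree.
  obtain ⟨m, hm⟩ := (Set.toFinite (τ '' s)).exists_maximal (hs.image τ)
  obtain ⟨⟨i₀, hi₀, rfl⟩, hmax⟩ := hm
  refine ⟨τ i₀, fun i hi => ?_⟩
  obtain ⟨x, hx, hx'⟩ := hpair i hi i₀ hi₀
  refine (h i hi x hx).2 _ ?_ (h i₀ hi₀ x hx').1
  rcases hN _ _ x (h i hi x hx).1 (h i₀ hi₀ x hx').1 with hle | hle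
  · exact hle
  · exact hmax ⟨i, hi, rfl⟩ hle

/-- The Erdős–Pósa property of subtrees. -/
theorem exists_disjoint_hitting {ι : Type v} {F : ι → Set N} (s : Finset ι)
    (hF : ∀ i ∈ s, IsSubtree (F i)) :
    ∃ s' ⊆ s, ∃ Z : Finset N, (∀ i ∈ s', ∀ j ∈ s', i ≠ j → Disjoint (F i) (F j)) ∧
      Z.card ≤ s'.card ∧ ∀ i ∈ s, ∃ z ∈ Z, z ∈ F i := by
  induction hn : s.card using Nat.strong_induction_on generalizing s with
  | _ n ih =>
  subst hn
  rcases s.eq_empty_or_nonempty with rfl | hs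
  · exact ⟨∅, le_rfl, ∅, by simp⟩
  have hF' := hF
  have : Nonempty N := by
    obtain ⟨i, hi⟩ := hs
    exact ⟨(hF i hi).choose⟩
  choose! τ hτ h using hF
  -- A subtree with maximal root joins the packing and its root joins the hitting set. Subtrees that
  -- avoid this root are disjoint from it, so induction handles them.
  obtain ⟨m, hm⟩ := (s.image τ).exists_maximal (hs.image τ)
  obtain ⟨hm1, hmax⟩ := hm
  obtain ⟨i₀, hi₀, rfl⟩ := Finset.mem_image.1 hm1
  set s₁ := s.filter fun i => τ i₀ ∉ F i with hs₁
  have hlt : s₁.card < s.card := by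
    apply Finset.card_lt_card
    rw [Finset.ssubset_iff_of_subset (Finset.filter_subset _ _)]
    exact ⟨i₀, hi₀, by simp [hτ i₀ hi₀]⟩
  obtain ⟨s', hs', Z, hd, hc, hh⟩ := ih _ hlt s₁ (fun i hi => hF' i (Finset.mem_filter.1 hi).1) rfl
  have hdis : ∀ i ∈ s', Disjoint (F i) (F i₀) := by
    intro i hi
    obtain ⟨his, hiτ⟩ := Finset.mem_filter.1 (hs' hi)
    rw [Set.disjoint_left]
    intro x hx hx'
    refine hiτ ((h i his x hx).2 _ ?_ (h i₀ hi₀ x hx').1)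
    rcases hN _ _ x (h i his x hx).1 (h i₀ hi₀ x hx').1 with hle | hle
    · exact hle
    · exact hmax (Finset.mem_image_of_mem _ his) hle
  have hi₀' : i₀ ∉ s' := fun hi => (Finset.mem_filter.1 (hs' hi)).2 (hτ i₀ hi₀)
  refine ⟨insert i₀ s', ?_, insert (τ i₀) Z, ?_, ?_, ?_⟩
  · exact Finset.insert_subset hi₀ (hs'.trans (Finset.filter_subset _ _))
  · intro i hi j hj hij
    rcases Finset.mem_insert.1 hi with hi | hi <;> rcases Finset.mem_insert.1 hj with hj | hj
    · exact absurd (hi.trans hj.symm) hij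
    · exact hi ▸ (hdis j hj).symm
    · exact hj ▸ hdis i hi
    · exact hd i hi j hj hij
  · rw [Finset.card_insert_of_notMem hi₀']
    exact (Finset.card_insert_le _ _).trans (Nat.add_le_add_right hc 1)
  · intro i hi
    by_cases hτi : τ i₀ ∈ F i
    · exact ⟨τ i₀, Finset.mem_insert_self _ _, hτi⟩
    · obtain ⟨z, hz, hzi⟩ := hh i (Finset.mem_filter.2 ⟨hi, hτi⟩)
      exact ⟨z, Finset.mem_insert_of_mem hz, hzi⟩

omit hN in
/-- `l` is the lowest common ancestor of `x` and `y`. -/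
def IsLCA (l x y : N) : Prop := l ≤ x ∧ l ≤ y ∧ ∀ a, a ≤ x → a ≤ y → a ≤ l

theorem exists_isLCA [Finite N] [OrderBot N] (x y : N) : ∃ l, IsLCA l x y := by
  obtain ⟨l, hl⟩ := (Set.toFinite {a : N | a ≤ x ∧ a ≤ y}).exists_maximal
    ⟨⊥, bot_le, bot_le⟩
  refine ⟨l, hl.1.1, hl.1.2, fun a hax hay => ?_⟩
  rcases hN _ _ x hax hl.1.1 with h | h
  · exact h
  · exact hl.2 ⟨hax, hay⟩ h

/-- Every set of nodes can be closed under lowest common ancestors by doubling its size. -/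
theorem exists_lca_closure [Finite N] [OrderBot N] (Z₀ : Finset N) :
    ∃ Z : Finset N, Z₀ ⊆ Z ∧ Z.card ≤ 2 * Z₀.card ∧ ∀ x ∈ Z, ∀ y ∈ Z, ∃ l ∈ Z, IsLCA l x y := by
  induction Z₀ using Finset.induction_on with
  | empty => exact ⟨∅, by simp⟩
  | insert z Z₀ hz ih =>
    obtain ⟨Z, hZ, hc, hl⟩ := ih
    have hself : ∀ a : N, IsLCA a a a := fun a => ⟨le_rfl, le_rfl, fun _ h _ => h⟩
    rcases Z.eq_empty_or_nonempty with rfl | hne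
    · refine ⟨{z}, ?_, by rw [Finset.card_insert_of_notMem hz, Finset.card_singleton]; omega, ?_⟩
      · rw [Finset.subset_empty.1 hZ]; rfl
      · intro x hx y hy
        rw [Finset.mem_singleton] at hx hy
        rw [hx, hy]
        exact ⟨z, by simp, hself z⟩
    choose L hL using fun y => exists_isLCA hN z y
    -- Besides z, one new node suffices: the greatest meet `L z₀`. Any other `L y` equals the lowest
    -- common ancestor of z₀ and y, which is already in Z.
    obtain ⟨m, hm⟩ := (Z.image L).exists_maximal (hne.image L)
    obtain ⟨hm1, hmax⟩ := hm
    obtain ⟨z₀, hz₀, rfl⟩ := Finset.mem_image.1 hm1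
    have hle : ∀ y ∈ Z, L y ≤ L z₀ := by
      intro y hy
      rcases hN _ _ z (hL y).1 (hL z₀).1 with h | h
      · exact h
      · exact hmax (Finset.mem_image_of_mem _ hy) h
    have hmem : ∀ y ∈ Z, L y ∈ insert (L z₀) Z := by
      intro y hy
      obtain ⟨m, hmZ, hm⟩ := hl z₀ hz₀ y hy
      have h1 : L y ≤ m := hm.2.2 _ ((hle y hy).trans (hL z₀).2.1) (hL y).2.1
      rcases hN _ _ z₀ hm.1 (hL z₀).2.1 with h | h
      · have h2 : m ≤ L y := (hL y).2.2 _ (h.trans (hL z₀).1) hm.2.1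
        rw [le_antisymm h1 h2]
        exact Finset.mem_insert_of_mem hmZ
      · have h2 : L z₀ ≤ L y := (hL y).2.2 _ (hL z₀).1 (h.trans hm.2.1)
        rw [le_antisymm (hle y hy) h2]
        exact Finset.mem_insert_self _ _
    have hlca : ∀ y ∈ Z, IsLCA (L y) (L z₀) y := fun y hy =>
      ⟨hle y hy, (hL y).2.1, fun a h1 h2 => (hL y).2.2 a (h1.trans (hL z₀).1) h2⟩
    have hsymm : ∀ {a x y : N}, IsLCA a x y → IsLCA a y x := fun h =>
      ⟨h.2.1, h.1, fun b h1 h2 => h.2.2 b h2 h1⟩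
    have hzl : IsLCA (L z₀) z (L z₀) := ⟨(hL z₀).1, le_rfl, fun a _ h => h⟩
    refine ⟨insert z (insert (L z₀) Z), ?_, ?_, ?_⟩
    · exact Finset.insert_subset_insert _ (hZ.trans (Finset.subset_insert _ _))
    · have h1 := Finset.card_insert_le z (insert (L z₀) Z)
      have h2 := Finset.card_insert_le (L z₀) Z
      rw [Finset.card_insert_of_notMem hz]
      omega
    · have hin : ∀ {a}, a ∈ insert (L z₀) Z → a ∈ insert z (insert (L z₀) Z) :=
        fun h => Finset.mem_insert_of_mem h
      have hLz : L z₀ ∈ insert z (insert (L z₀) Z) := by simp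
      intro x hx y hy
      simp only [Finset.mem_insert] at hx hy
      rcases hx with rfl | rfl | hx <;> rcases hy with rfl | rfl | hy
      · exact ⟨_, by simp, hself _⟩
      · exact ⟨_, hLz, hzl⟩
      · exact ⟨_, hin (hmem y hy), hL y⟩
      · exact ⟨_, hLz, hsymm hzl⟩
      · exact ⟨_, hLz, hself _⟩
      · exact ⟨_, hin (hmem y hy), hlca y hy⟩
      · exact ⟨_, hin (hmem x hx), hsymm (hL x)⟩
      · exact ⟨_, hin (hmem x hx), hsymm (hlca x hx)⟩
      · obtain ⟨l, hlZ, h⟩ := hl x hx y hy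
        exact ⟨l, hin (Finset.mem_insert_of_mem hlZ), h⟩

omit hN in
/-- `D` is a union of subtrees hanging below the node `t`. -/
def IsBranchSet (t : N) (D : Set N) : Prop :=
  (∀ i ∈ D, t < i) ∧ ∀ i j, t < i → i ≤ j → (i ∈ D ↔ j ∈ D)

/-- The root of F is comparable with t, since both lie below i. As t is not in F, the root lies
strictly above t, hence in D, and all of F follows. -/
theorem IsBranchSet.subset_of_mem {t : N} {D F : Set N} (hD : IsBranchSet t D)
    (hF : IsSubtree F) (ht : t ∉ F) {i : N} (hi : i ∈ F) (hiD : i ∈ D) : F ⊆ D := by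
  have hF' := hF
  obtain ⟨τ, hτ, h⟩ := hF
  have htτ : t < τ := by
    rcases hN _ _ i (hD.1 i hiD).le (h i hi).1 with h1 | h1
    · exact lt_of_le_of_ne h1 fun h => ht (h ▸ hτ)
    · exact absurd (hF'.mem_of_le_of_le hτ hi h1 (hD.1 i hiD).le) ht
  have hτD : τ ∈ D := (hD.2 τ i htτ (h i hi).1).2 hiD
  exact fun j hj => (hD.2 τ j htτ (h j hj).1).1 hτD

/-- A set of at least `W` items at the nodes of a tree has a subset of between `W` and `2 * W`
items that is cut off by a single node. -/
theorem exists_split [Finite N] [OrderBot N] {ι : Type v} (s : Finset ι) (τ : ι → N) {W : ℕ}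
    (hW : W ≤ s.card) :
    ∃ (t : N) (D : Set N) (I : Finset ι), IsBranchSet t D ∧ I ⊆ s ∧ W ≤ I.card ∧
      I.card ≤ 2 * W ∧ (∀ i ∈ s, τ i ∈ D → i ∈ I) ∧ ∀ i ∈ I, τ i ∈ D ∨ τ i = t := by
  have hbot : W ≤ (s.filter fun i => (⊥ : N) ≤ τ i).card := by simpa using hW
  -- With t maximal, every branch at t carries fewer than W items.
  obtain ⟨t, ht⟩ := (Set.toFinite {t : N | W ≤ (s.filter fun i => t ≤ τ i).card}).exists_maximal
    ⟨⊥, hbot⟩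
  obtain ⟨htW, hmax⟩ := ht
  have hlt : ∀ c, t < c → (s.filter fun i => c ≤ τ i).card < W := by
    intro c hc
    by_contra hle
    exact absurd (hmax (not_lt.1 hle) hc.le) (not_le_of_gt hc)
  set A : Set N := {i | t < i} with hA
  have hAb : IsBranchSet t A := ⟨fun i hi => hi, fun i j h1 h2 =>
    ⟨fun _ => lt_of_lt_of_le h1 h2, fun _ => h1⟩⟩
  by_cases hAW : W ≤ (s.filter fun i => τ i ∈ A).card
  -- Take a minimal union of branches with at least W items. Dropping one branch leaves fewer than
  -- W, and that branch has fewer than W.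
  · obtain ⟨D, hD⟩ := (Set.toFinite {D : Set N | IsBranchSet t D ∧
      W ≤ (s.filter fun i => τ i ∈ D).card}).exists_minimal ⟨A, hAb, hAW⟩
    obtain ⟨⟨hDb, hDW⟩, hmin⟩ := hD
    refine ⟨t, D, s.filter fun i => τ i ∈ D, hDb, Finset.filter_subset _ _, hDW, ?_,
      fun i hi h => Finset.mem_filter.2 ⟨hi, h⟩, fun i hi => Or.inl (Finset.mem_filter.1 hi).2⟩
    rcases D.eq_empty_or_nonempty with rfl | hne
    · simp
    obtain ⟨c, hc⟩ := (Set.toFinite D).exists_minimal hne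
    have htc := hDb.1 c hc.1
    obtain ⟨D', hD'⟩ : ∃ D' : Set N, ∀ i, i ∈ D' ↔ i ∈ D ∧ ¬ c ≤ i :=
      ⟨{i | i ∈ D ∧ ¬ c ≤ i}, fun _ => Iff.rfl⟩
    have hDb' : IsBranchSet t D' := by
      refine ⟨fun i hi => hDb.1 i ((hD' i).1 hi).1, fun i j h1 h2 => ?_⟩
      have h3 := hDb.2 i j h1 h2
      rw [hD', hD', h3]
      refine and_congr_right fun hj => not_congr ⟨fun h => h.trans h2, fun h => ?_⟩
      rcases hN _ _ j h h2 with h4 | h4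
      · exact h4
      · exact hc.2 (h3.2 hj) h4
    have hlt' : (s.filter fun i => τ i ∈ D').card < W := by
      by_contra hle
      have := hmin ⟨hDb', not_lt.1 hle⟩ (fun i hi => ((hD' i).1 hi).1) hc.1
      exact ((hD' c).1 this).2 le_rfl
    have hsub : (s.filter fun i => τ i ∈ D) ⊆
        (s.filter fun i => τ i ∈ D') ∪ (s.filter fun i => c ≤ τ i) := by
      intro i hi
      obtain ⟨his, hiD⟩ := Finset.mem_filter.1 hi
      by_cases hci : c ≤ τ i
      · exact Finset.mem_union_right _ (Finset.mem_filter.2 ⟨his, hci⟩)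
      · exact Finset.mem_union_left _ (Finset.mem_filter.2 ⟨his, (hD' _).2 ⟨hiD, hci⟩⟩)
    have h1 := (Finset.card_le_card hsub).trans (Finset.card_union_le _ _)
    have h2 := hlt c htc
    omega
  -- The branches alone carry too few items, but items at t itself can be added singly to reach
  -- exactly W.
  · have hsub : (s.filter fun i => τ i ∈ A) ⊆ s.filter fun i => t ≤ τ i := fun i hi =>
      Finset.mem_filter.2 ⟨(Finset.mem_filter.1 hi).1, le_of_lt (Finset.mem_filter.1 hi).2⟩
    obtain ⟨I, hI1, hI2, hI3⟩ := Finset.exists_subsuperset_card_eq hsub (not_le.1 hAW).le htW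
    refine ⟨t, A, I, hAb, hI2.trans (Finset.filter_subset _ _), hI3.ge, by omega,
      fun i hi h => hI1 (Finset.mem_filter.2 ⟨hi, h⟩), fun i hi => ?_⟩
    rcases eq_or_lt_of_le (Finset.mem_filter.1 (hI2 hi)).2 with h | h
    · exact Or.inr h.symm
    · exact Or.inl h

end TreeOrder

end Mergeable

namespace Mergeable

/-! ### The ancestor order of a rooted tree -/

section RootedOrder

universe u v

variable {N : Type u} {T : SimpleGraph N}

theorem isPath_append_of_inter {a b c : N} {p : T.Walk a b} {q : T.Walk b c} (hp : p.IsPath)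
    (hq : q.IsPath) (h : ∀ v, v ∈ p.support → v ∈ q.support → v = b) : (p.append q).IsPath := by
  rw [SimpleGraph.Walk.isPath_def, SimpleGraph.Walk.support_append]
  have hq' : (b :: q.support.tail).Nodup := by
    rw [SimpleGraph.Walk.cons_tail_support]
    exact hq.support_nodup
  refine List.Nodup.append hp.support_nodup (List.nodup_cons.1 hq').2 fun v hv hv' => ?_
  have := h v hv (List.mem_of_mem_tail hv')
  subst this
  exact (List.nodup_cons.1 hq').1 hv'

theorem isAncestor_iff_append {r a x : N} :
    IsAncestor T r a x ↔ ∃ (p : T.Walk r a) (q : T.Walk a x), (p.append q).IsPath := by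
  constructor
  · rintro ⟨p, hp, ha⟩
    obtain ⟨q, r, -, -, rfl⟩ := hp.mem_support_iff_exists_append.1 ha
    exact ⟨q, r, hp⟩
  · rintro ⟨p, q, h⟩
    exact ⟨p.append q, h, by simp⟩

theorem isAncestor_of_mem_support {r a x : N} {p : T.Walk r x} (hp : p.IsPath)
    (ha : a ∈ p.support) : IsAncestor T r a x := ⟨p, hp, ha⟩

theorem IsAncestor.mem_support (hT : T.IsTree) {r a x : N} (h : IsAncestor T r a x)
    {p : T.Walk r x} (hp : p.IsPath) : a ∈ p.support := by
  obtain ⟨q, hq, ha⟩ := h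
  rwa [(hT.existsUnique_path r x).unique hp hq]

theorem IsAncestor.trans (hT : T.IsTree) {r a b x : N} (h : IsAncestor T r a b)
    (h' : IsAncestor T r b x) : IsAncestor T r a x := by
  obtain ⟨p, q, hpq⟩ := isAncestor_iff_append.1 h'
  refine ⟨_, hpq, ?_⟩
  rw [SimpleGraph.Walk.mem_support_append_iff]
  exact Or.inl (h.mem_support hT hpq.of_append_left)

theorem IsAncestor.antisymm (hT : T.IsTree) {r a b : N} (h : IsAncestor T r a b)
    (h' : IsAncestor T r b a) : a = b := by
  obtain ⟨p, q, hpq⟩ := isAncestor_iff_append.1 h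
  have hb := h'.mem_support hT hpq.of_append_left
  by_contra hne
  exact hpq.ne_of_mem_support_of_append (Ne.symm hne) hb q.end_mem_support rfl

theorem IsAncestor.total (hT : T.IsTree) {r a b x : N} (ha : IsAncestor T r a x)
    (hb : IsAncestor T r b x) : IsAncestor T r a b ∨ IsAncestor T r b a := by
  obtain ⟨p, q, hpq⟩ := isAncestor_iff_append.1 ha
  have hb' := hb.mem_support hT hpq
  rw [SimpleGraph.Walk.mem_support_append_iff] at hb'
  rcases hb' with hb' | hb'
  · exact Or.inr ⟨p, hpq.of_append_left, hb'⟩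
  · left
    obtain ⟨q₁, q₂, -, -, rfl⟩ := hpq.of_append_right.mem_support_iff_exists_append.1 hb'
    rw [SimpleGraph.Walk.append_assoc] at hpq
    exact isAncestor_iff_append.2 ⟨p, q₁, hpq.of_append_left⟩

/-- The ancestor relation of a rooted tree as a partial order. -/
abbrev ancestorOrder (hT : T.IsTree) (r : N) : PartialOrder N where
  le a x := IsAncestor T r a x
  le_refl a := by
    obtain ⟨p, hp, -⟩ := hT.existsUnique_path r a
    exact ⟨p, hp, p.end_mem_support⟩
  le_trans _ _ _ h h' := h.trans hT h'
  le_antisymm _ _ h h' := h.antisymm hT h'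

/-- A minimal node τ of F is its root: the path from r to τ meets F only in τ, so prolonging it by a
path inside F gives a path of T. -/
theorem isSubtree_of_connected [Finite N] (hT : T.IsTree) (r : N) {F : Set N}
    (hF : (T.induce F).Connected) : @IsSubtree N (ancestorOrder hT r) F := by
  let _ := ancestorOrder hT r
  obtain ⟨τ, hτ, hmin⟩ := (Set.toFinite F).exists_minimal (by
    obtain ⟨⟨x, hx⟩⟩ := hF.nonempty
    exact ⟨x, hx⟩)
  refine ⟨τ, hτ, fun y hy => ?_⟩
  obtain ⟨p, hp, -⟩ := hT.existsUnique_path r τ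
  obtain ⟨q, hqp, hqF⟩ : ∃ q : T.Walk τ y, q.IsPath ∧ ∀ v ∈ q.support, v ∈ F := by
    obtain ⟨w, hw⟩ := hF.preconnected.exists_isPath ⟨τ, hτ⟩ ⟨y, hy⟩
    refine ⟨w.map (SimpleGraph.Embedding.induce F).toHom, hw.map Subtype.val_injective,
      fun v hv => ?_⟩
    have hv' : v ∈ (w.map (SimpleGraph.Embedding.induce F).toHom).support := hv
    rw [SimpleGraph.Walk.support_map, List.mem_map] at hv'
    obtain ⟨v', -, rfl⟩ := hv'
    exact v'.2
  have hpq : (p.append q).IsPath := isPath_append_of_inter hp hqp fun v hv hv' => by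
    have hle : v ≤ τ := isAncestor_of_mem_support hp hv
    exact le_antisymm hle (hmin (hqF v hv') hle)
  refine ⟨isAncestor_iff_append.2 ⟨p, q, hpq⟩, fun j hj hj' => ?_⟩
  have := IsAncestor.mem_support hT hj' hpq
  rw [SimpleGraph.Walk.mem_support_append_iff] at this
  rcases this with h | h
  · have hle : j ≤ τ := isAncestor_of_mem_support hp h
    rw [le_antisymm hle hj]
    exact hτ
  · exact hqF j h

end RootedOrder

/-! ### Tree decompositions and modulators -/

section Treewidth

open scoped Classical

universe u v

variable {V : Type u} [Finite V] (G : SimpleGraph V)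

/-- The infimum is attained: the one-bag decomposition makes the set of widths non-empty, and -1
bounds it below because a tree has a node. -/
theorem exists_treeDecomposition {η : ℤ} (h : treewidth G ≤ η) :
    ∃ (n : ℕ) (T : SimpleGraph (Fin n)) (bag : Fin n → Finset V),
      IsTreeDecomposition G T bag ∧ ∀ x, ((bag x).card : ℤ) - 1 ≤ η := by
  have hmem := Int.csInf_mem (s := {w : ℤ | ∃ (n : ℕ) (T : SimpleGraph (Fin n))
    (bag : Fin n → Finset V), IsTreeDecomposition G T bag ∧ ∀ x, ((bag x).card : ℤ) - 1 ≤ w})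
    ?_ ?_
  · obtain ⟨n, T, bag, hT, hb⟩ := hmem
    exact ⟨n, T, bag, hT, fun x => (hb x).trans h⟩
  · have := Fintype.ofFinite V
    refine ⟨Fintype.card V, 1, ⊥, fun _ => Finset.univ, ⟨SimpleGraph.IsTree.of_subsingleton,
      fun a => ⟨0, by simp⟩, fun a b _ => ⟨0, by simp⟩, fun a => ?_⟩, fun x => by simp⟩
    have : Nonempty {x : Fin 1 | a ∈ (Finset.univ : Finset V)} := ⟨⟨0, by simp⟩⟩
    exact SimpleGraph.IsTree.of_subsingleton.connected
  · refine ⟨-1, ?_⟩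
    rintro w ⟨n, T, bag, hT, hb⟩
    obtain ⟨x⟩ := hT.1.connected.nonempty
    have := hb x
    omega

omit [Finite V] in
theorem treewidth_le_of_treeDecomposition {w : ℤ} {n : ℕ} {T : SimpleGraph (Fin n)}
    {bag : Fin n → Finset V} (hT : IsTreeDecomposition G T bag)
    (hw : ∀ x, ((bag x).card : ℤ) - 1 ≤ w) : treewidth G ≤ w := by
  refine csInf_le ⟨-1, ?_⟩ ⟨n, T, bag, hT, hw⟩
  rintro w ⟨n, T, bag, hT, hb⟩
  obtain ⟨x⟩ := hT.1.connected.nonempty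
  have := hb x
  omega

/-- An induced subgraph with few vertices of a modulator has small treewidth. -/
theorem treewidth_induce_le {η : ℤ} {X : Finset V} (h : IsTreewidthModulator G η X) (S : Set V)
    {m : ℕ} (hm : (S ∩ X).ncard ≤ m) : treewidth (G.induce S) ≤ η + m := by
  have := Fintype.ofFinite V
  obtain ⟨n, T, bag, hT, hw⟩ := exists_treeDecomposition _ h
  -- The modulator vertices in S are added to every bag.
  set bag' : Fin n → Finset S := fun t => Finset.univ.filter fun v =>
    (v : V) ∈ X ∨ ∃ hv : (v : V) ∈ (X : Set V)ᶜ, (⟨v, hv⟩ : ((X : Set V)ᶜ : Set V)) ∈ bag t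
    with hbag'
  have hmem : ∀ t v, v ∈ bag' t ↔ (v : V) ∈ X ∨
      ∃ hv : (v : V) ∈ (X : Set V)ᶜ, (⟨v, hv⟩ : ((X : Set V)ᶜ : Set V)) ∈ bag t := by
    intro t v; simp [hbag']
  obtain ⟨t₀⟩ := hT.1.connected.nonempty
  refine treewidth_le_of_treeDecomposition _ (T := T) (bag := bag') ⟨hT.1, ?_, ?_, ?_⟩ ?_
  · intro a
    by_cases ha : (a : V) ∈ X
    · exact ⟨t₀, (hmem _ _).2 (Or.inl ha)⟩
    · obtain ⟨t, ht⟩ := hT.2.1 ⟨a, ha⟩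
      exact ⟨t, (hmem _ _).2 (Or.inr ⟨ha, ht⟩)⟩
  · intro a b hab
    by_cases ha : (a : V) ∈ X
    · by_cases hb : (b : V) ∈ X
      · exact ⟨t₀, (hmem _ _).2 (Or.inl ha), (hmem _ _).2 (Or.inl hb)⟩
      · obtain ⟨t, ht⟩ := hT.2.1 ⟨b, hb⟩
        exact ⟨t, (hmem _ _).2 (Or.inl ha), (hmem _ _).2 (Or.inr ⟨hb, ht⟩)⟩
    · by_cases hb : (b : V) ∈ X
      · obtain ⟨t, ht⟩ := hT.2.1 ⟨a, ha⟩
        exact ⟨t, (hmem _ _).2 (Or.inr ⟨ha, ht⟩), (hmem _ _).2 (Or.inl hb)⟩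
      · obtain ⟨t, ht, ht'⟩ := hT.2.2.1 ⟨a, ha⟩ ⟨b, hb⟩ hab
        exact ⟨t, (hmem _ _).2 (Or.inr ⟨ha, ht⟩), (hmem _ _).2 (Or.inr ⟨hb, ht'⟩)⟩
  · intro a
    by_cases ha : (a : V) ∈ X
    · have : {x | a ∈ bag' x} = Set.univ :=
        Set.eq_univ_of_forall fun t => (hmem _ _).2 (Or.inl ha)
      rw [this]
      exact (SimpleGraph.induceUnivIso T).connected_iff.2 hT.1.connected
    · have : {x | a ∈ bag' x} = {x | (⟨a, ha⟩ : ((X : Set V)ᶜ : Set V)) ∈ bag x} := by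
        ext t
        exact (hmem t a).trans ⟨fun h => h.elim (fun h => absurd h ha) fun ⟨_, h⟩ => h,
          fun h => Or.inr ⟨ha, h⟩⟩
      rw [this]
      exact hT.2.2.2 ⟨a, ha⟩
  · intro t
    have hc : (bag' t).card ≤ (S ∩ X).ncard + (bag t).card := by
      rw [← Finset.card_map ⟨Subtype.val, Subtype.val_injective⟩,
        ← Finset.card_map (s := bag t) ⟨Subtype.val, Subtype.val_injective⟩,
        Set.ncard_eq_toFinset_card']
      refine (Finset.card_le_card ?_).trans (Finset.card_union_le _ _)
      intro v hv
      obtain ⟨a, ha, rfl⟩ := Finset.mem_map.1 hv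
      rcases (hmem _ _).1 ha with h | ⟨h, h'⟩
      · exact Finset.mem_union_left _ (by simpa using h)
      · exact Finset.mem_union_right _ (Finset.mem_map.2 ⟨_, h', rfl⟩)
    have := hw t
    have : ((bag' t).card : ℤ) ≤ m + (bag t).card := by exact_mod_cast hc.trans (by omega)
    omega

/-- A family of bags at the nodes of a rooted tree, such that the bags that contain a vertex
outside `X` form a subtree, and adjacent vertices outside `X` have a common bag. -/
structure IsRootedDecomposition {N : Type v} [PartialOrder N] (X : Set V) (bag : N → Finset V)
    (w : ℕ) : Prop where
  card_le : ∀ t, (bag t).card ≤ w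
  notMem : ∀ t, ∀ x ∈ bag t, x ∉ X
  isSubtree : ∀ x ∉ X, IsSubtree {t | x ∈ bag t}
  adj : ∀ x y, x ∉ X → y ∉ X → G.Adj x y → ∃ t, x ∈ bag t ∧ y ∈ bag t

/-- The tree is ordered from an arbitrary root. The bound `η.toNat + 1` on the bags is also correct
for negative η. -/
theorem exists_rootedDecomposition {η : ℤ} {X : Finset V} (h : IsTreewidthModulator G η X) :
    ∃ (N : Type) (_ : PartialOrder N) (_ : OrderBot N) (_ : Finite N) (bag : N → Finset V),
      IsForestOrder N ∧ IsRootedDecomposition G (X : Set V) bag (η.toNat + 1) := by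
  obtain ⟨N, _, T, bag, hT, hw⟩ : ∃ (N : Type) (_ : Finite N) (T : SimpleGraph N)
      (bag : N → Finset ((X : Set V)ᶜ : Set V)), IsTreeDecomposition (G.induce (X : Set V)ᶜ) T bag ∧
      ∀ x, ((bag x).card : ℤ) - 1 ≤ η := by
    obtain ⟨n, T, bag, h⟩ := exists_treeDecomposition _ h
    exact ⟨Fin n, inferInstance, T, bag, h⟩
  obtain ⟨r⟩ := hT.1.connected.nonempty
  have hmem : ∀ t v, v ∈ (bag t).map ⟨Subtype.val, Subtype.val_injective⟩ ↔
      ∃ hv : v ∈ (X : Set V)ᶜ, (⟨v, hv⟩ : ((X : Set V)ᶜ : Set V)) ∈ bag t := by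
    intro t v
    simp
  let _ := ancestorOrder hT.1 r
  have hbot : ∀ a : N, r ≤ a := by
    intro a
    obtain ⟨p, hp, -⟩ := hT.1.existsUnique_path r a
    exact ⟨p, hp, p.start_mem_support⟩
  refine ⟨N, inferInstance, { bot := r, bot_le := hbot }, inferInstance,
    fun t => (bag t).map ⟨Subtype.val, Subtype.val_injective⟩, ?_, ?_⟩
  · exact fun a b x ha hb => IsAncestor.total hT.1 ha hb
  · refine ⟨?_, ?_, ?_, ?_⟩
    · intro t
      rw [Finset.card_map]
      have := hw t
      omega
    · intro t x hx
      exact ((hmem t x).1 hx).1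
    · intro x hx
      have : {t | x ∈ (bag t).map ⟨Subtype.val, Subtype.val_injective⟩} =
          {t | (⟨x, hx⟩ : ((X : Set V)ᶜ : Set V)) ∈ bag t} := by
        ext t
        exact (hmem t x).trans ⟨fun ⟨_, h⟩ => h, fun h => ⟨hx, h⟩⟩
      rw [this]
      exact isSubtree_of_connected hT.1 r (hT.2.2.2 ⟨x, hx⟩)
    · intro x y hx hy hxy
      obtain ⟨t, h1, h2⟩ := hT.2.2.1 ⟨x, hx⟩ ⟨y, hy⟩ hxy
      exact ⟨t, (hmem t x).2 ⟨hx, h1⟩, (hmem t y).2 ⟨hy, h2⟩⟩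

end Treewidth

end Mergeable

namespace Mergeable

/-! ### Well-linked sets and internal components -/

section Hypergraph

open scoped Classical

universe u v w

namespace MultiHypergraph

variable {V : Type u} {E : Type v} (X : MultiHypergraph V E)

/-- Two hyperedges of `A` that have a vertex of `O` in common. -/
def Link (A : Set E) (O : Set V) (a b : E) : Prop :=
  a ∈ A ∧ b ∈ A ∧ ∃ v ∈ O, v ∈ X.inc a ∧ v ∈ X.inc b

/-- Hyperedges of `A` that are joined by a sequence of hyperedges of `A`, consecutive ones having
a vertex of `O` in common. -/
def Linked (A : Set E) (O : Set V) : E → E → Prop := Relation.ReflTransGen (X.Link A O)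

variable {X}

theorem Link.symm {A : Set E} {O : Set V} {a b : E} (h : X.Link A O a b) : X.Link A O b a := by
  obtain ⟨ha, hb, v, hv, hva, hvb⟩ := h
  exact ⟨hb, ha, v, hv, hvb, hva⟩

theorem Linked.symm {A : Set E} {O : Set V} {a b : E} (h : X.Linked A O a b) :
    X.Linked A O b a := by
  induction h with
  | refl => exact Relation.ReflTransGen.refl
  | tail _ hbc ih => exact Relation.ReflTransGen.head hbc.symm ih

theorem Linked.trans {A : Set E} {O : Set V} {a b c : E} (h : X.Linked A O a b)
    (h' : X.Linked A O b c) : X.Linked A O a c := Relation.ReflTransGen.trans h h'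

theorem Linked.mem {A : Set E} {O : Set V} {a b : E} (ha : a ∈ A) (h : X.Linked A O a b) :
    b ∈ A := by
  rcases Relation.ReflTransGen.cases_tail h with rfl | ⟨c, -, hc⟩
  · exact ha
  · exact hc.2.1

theorem Linked.tail {A : Set E} {O : Set V} {a b c : E} (h : X.Linked A O a b)
    (h' : X.Link A O b c) : X.Linked A O a c := Relation.ReflTransGen.tail h h'

variable (X) in
/-- `C` is a part of `A` that shares with the rest of `A` only vertices of the boundary of `A`. -/
def IsClosedIn (A C : Set E) : Prop :=
  C ⊆ A ∧ ∀ a ∈ C, ∀ b ∈ A, ∀ v, v ∉ X.bd A → v ∈ X.inc a → v ∈ X.inc b → b ∈ C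

theorem IsClosedIn.bd_subset {A C : Set E} (h : X.IsClosedIn A C) : X.bd C ⊆ X.bd A := by
  rintro v ⟨⟨a, ha, hva⟩, b, hb, hvb⟩
  by_contra hv
  by_cases hbA : b ∈ A
  · exact hb (h.2 a ha b hbA v hv hva hvb)
  · exact hv ⟨⟨a, h.1 ha, hva⟩, b, hbA, hvb⟩

theorem IsClosedIn.diff {A C : Set E} (h : X.IsClosedIn A C) : X.IsClosedIn A (A \ C) :=
  ⟨Set.sdiff_subset, fun a ha b hb v hv hva hvb =>
    ⟨hb, fun hbC => ha.2 (h.2 b hbC a ha.1 v hv hvb hva)⟩⟩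

/-- Any two boundary vertices of a well-linked set are linked through its interior. -/
theorem WellLinked.exists_linked [Finite V] {L : Set E} (hL : X.WellLinked L) {x y : V}
    (hx : x ∈ X.bd L) (hy : y ∈ X.bd L) :
    ∃ a ∈ L, ∃ b ∈ L, x ∈ X.inc a ∧ y ∈ X.inc b ∧ X.Linked L (X.bd L)ᶜ a b := by
  by_contra! hno
  -- The hyperedges reached from x and the remaining ones are both closed in L, so their boundaries
  -- lie in `X.bd L`. The first boundary misses y and the second misses x, against well-linkedness.
  set A : Set E := {b | b ∈ L ∧ ∃ a ∈ L, x ∈ X.inc a ∧ X.Linked L (X.bd L)ᶜ a b} with hA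
  have hAc : X.IsClosedIn L A := by
    refine ⟨fun b hb => hb.1, ?_⟩
    rintro b ⟨hb, a, ha, hxa, hab⟩ c hc v hv hvb hvc
    exact ⟨hc, a, ha, hxa, hab.tail ⟨hb, hc, v, hv, hvb, hvc⟩⟩
  have h1 : X.lam A < X.lam L := by
    refine Set.ncard_lt_ncard ?_ (Set.toFinite _)
    refine (Set.ssubset_iff_of_subset hAc.bd_subset).2 ⟨y, hy, ?_⟩
    rintro ⟨⟨b, ⟨hb, a, ha, hxa, hab⟩, hyb⟩, -⟩
    exact hno a ha b hb hxa hyb hab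
  have h2 : X.lam (L \ A) < X.lam L := by
    refine Set.ncard_lt_ncard ?_ (Set.toFinite _)
    refine (Set.ssubset_iff_of_subset hAc.diff.bd_subset).2 ⟨x, hx, ?_⟩
    rintro ⟨⟨b, ⟨hb, hbA⟩, hxb⟩, -⟩
    exact hbA ⟨hb, b, hb, hxb, Relation.ReflTransGen.refl⟩
  rcases hL A (L \ A) (Set.union_sdiff_cancel hAc.1) disjoint_sdiff_self_right with h | h <;> omega

/-- Linked hyperedges are connected in `G` if the vertices of each hyperedge are. -/
theorem Linked.connIn {G : SimpleGraph V} {A : Set E} {O S : Set V} {J : E → Set V}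
    (hJ : ∀ a ∈ A, ∀ x ∈ X.inc a, ∀ y ∈ X.inc a, ConnIn G (J a ∪ {x, y}) x y)
    (hJS : ∀ a ∈ A, J a ⊆ S) (hOS : ∀ v ∈ O, ∀ a ∈ A, v ∈ X.inc a → v ∈ S) {a b : E}
    (hab : X.Linked A O a b) (ha : a ∈ A) {x y : V} (hx : x ∈ X.inc a) (hy : y ∈ X.inc b) :
    ConnIn G (S ∪ {x, y}) x y := by
  induction hab using Relation.ReflTransGen.head_induction_on generalizing x with
  | refl => exact (hJ b ha x hx y hy).mono (Set.union_subset_union_left _ (hJS b ha))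
  | @head a c h hc ih =>
    obtain ⟨-, hcA, v, hv, hva, hvc⟩ := h
    have hvS := hOS v hv a ha hva
    refine ((hJ a ha x hx v hva).mono ?_).trans ((ih hcA hvc).mono ?_)
    · rintro z (hz | rfl | rfl)
      · exact Or.inl (hJS a ha hz)
      · exact Or.inr (Or.inl rfl)
      · exact Or.inl hvS
    · rintro z (hz | rfl | rfl)
      · exact Or.inl hz
      · exact Or.inl hvS
      · exact Or.inr (Or.inr rfl)

/-- In every set of hyperedges, a large part has only internal components with the same
boundary. -/
theorem exists_uniform_subset [Finite V] [Finite E] (B : Set E) {γ : ℕ} (hB : X.lam B ≤ γ) :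
    ∃ B₁ ⊆ B, X.lam B₁ ≤ γ ∧ B.ncard ≤ 2 ^ γ * B₁.ncard ∧
      ∀ B', X.IsInternalComponent B₁ B' → X.bd B' = X.bd B₁ := by
  have := Fintype.ofFinite V
  have := Fintype.ofFinite E
  -- Each class has its boundary inside `X.bd B`, so at most `2 ^ γ` boundaries occur. B₁ collects
  -- the classes with a most frequent boundary, and its internal components are classes.
  set cls : E → Set E := fun e => {e' | e' ∈ B ∧ X.Linked B (X.bd B)ᶜ e e'} with hcls
  have hself : ∀ e ∈ B, e ∈ cls e := fun e he => ⟨he, Relation.ReflTransGen.refl⟩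
  have hclosed : ∀ e, X.IsClosedIn B (cls e) := by
    refine fun e => ⟨fun b hb => hb.1, ?_⟩
    rintro a ⟨ha, hea⟩ b hb v hv hva hvb
    exact ⟨hb, hea.tail ⟨ha, hb, v, hv, hva, hvb⟩⟩
  have hcls_eq : ∀ e e', e' ∈ cls e → cls e' = cls e := by
    rintro e e' ⟨he', h⟩
    ext a
    exact ⟨fun ha => ⟨ha.1, h.trans ha.2⟩, fun ha => ⟨ha.1, h.symm.trans ha.2⟩⟩
  obtain ⟨S, hS⟩ : ∃ S : Set V, B.ncard ≤ 2 ^ γ * {e | e ∈ B ∧ X.bd (cls e) = S}.ncard := by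
    set P : Finset (Finset V) := (X.bd B).toFinset.powerset with hP
    have hmaps : ∀ e ∈ B.toFinset, (X.bd (cls e)).toFinset ∈ P := by
      intro e _
      rw [hP, Finset.mem_powerset]
      exact Set.toFinset_subset_toFinset.2 (hclosed e).bd_subset
    obtain ⟨S, hS, hmax⟩ := Finset.exists_max_image P
      (fun S => (B.toFinset.filter fun e => (X.bd (cls e)).toFinset = S).card)
      ⟨∅, Finset.empty_mem_powerset _⟩
    refine ⟨S, ?_⟩
    rw [Set.ncard_eq_toFinset_card', Set.ncard_eq_toFinset_card',
      Finset.card_eq_sum_card_fiberwise hmaps]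
    refine (Finset.sum_le_card_nsmul P _ _ hmax).trans ?_
    rw [smul_eq_mul]
    refine Nat.mul_le_mul ?_ (Finset.card_le_card ?_)
    · rw [hP, Finset.card_powerset, ← Set.ncard_eq_toFinset_card']
      exact Nat.pow_le_pow_right (by norm_num) hB
    · intro e he
      obtain ⟨h1, h2⟩ := Finset.mem_filter.1 he
      rw [Set.mem_toFinset] at h1 ⊢
      refine ⟨h1, ?_⟩
      rw [← h2, Set.coe_toFinset]
  set B₁ : Set E := {e | e ∈ B ∧ X.bd (cls e) = S} with hB₁
  have hsub : ∀ e ∈ B₁, cls e ⊆ B₁ := fun e he a ha =>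
    ⟨ha.1, by rw [hcls_eq e a ha]; exact he.2⟩
  have hbd : ∀ e ∈ B₁, X.bd B₁ = S := by
    intro e he
    apply Set.Subset.antisymm
    · rintro v ⟨⟨a, ha, hva⟩, b, hb, hvb⟩
      rw [← ha.2]
      exact ⟨⟨a, hself a ha.1, hva⟩, b, fun h => hb (hsub a ha h), hvb⟩
    · intro v hv
      have hvB : v ∈ X.bd B := (hclosed e).bd_subset (he.2 ▸ hv)
      obtain ⟨⟨a, ha, hva⟩, -⟩ : v ∈ X.bd (cls e) := he.2 ▸ hv
      obtain ⟨-, b, hb, hvb⟩ := hvB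
      exact ⟨⟨a, hsub e he ha, hva⟩, b, fun h => hb h.1, hvb⟩
  refine ⟨B₁, fun e he => he.1, ?_, hS, ?_⟩
  · rcases B₁.eq_empty_or_nonempty with h | ⟨e, he⟩
    · rw [h]
      simp [lam, bd, verts]
    · refine le_trans (Set.ncard_le_ncard ?_ (Set.toFinite _)) hB
      rw [hbd e he, ← he.2]
      exact (hclosed e).bd_subset
  · rintro B' ⟨⟨hB'sub, ⟨e, he⟩, hB'c⟩, hmax⟩
    have heB₁ := hB'sub he
    -- Otherwise the class cuts B' into a forbidden bipartition: a vertex of `X.bd B` on B' lies on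
    -- a hyperedge outside B, hence in `X.bd B'`.
    have hB'cls : B' ⊆ cls e := by
      by_contra hnot
      obtain ⟨e', he', hne⟩ := Set.not_subset.1 hnot
      refine hB'c ⟨B' ∩ cls e, B' \ cls e, ⟨e, he, hself e heB₁.1⟩, ⟨e', he', hne⟩,
        Set.inter_union_sdiff _ _, Set.disjoint_left.2 fun a h h' => h'.2 h.2, ?_, ?_⟩
      · rintro v ⟨⟨a, ha, hva⟩, b, hb, hvb⟩
        by_contra hv
        have hB : v ∉ X.bd B := by
          rintro ⟨-, c, hc, hvc⟩
          exact hv ⟨⟨a, ha.1, hva⟩, c, fun h => hc (hB'sub h).1, hvc⟩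
        have hbB' : b ∈ B' := by
          by_contra h
          exact hv ⟨⟨a, ha.1, hva⟩, b, h, hvb⟩
        exact hb ⟨hbB', (hclosed e).2 a ha.2 b (hB'sub hbB').1 v hB hva hvb⟩
      · rintro v ⟨⟨a, ha, hva⟩, b, hb, hvb⟩
        by_contra hv
        have hB : v ∉ X.bd B := by
          rintro ⟨-, c, hc, hvc⟩
          exact hv ⟨⟨a, ha.1, hva⟩, c, fun h => hc (hB'sub h).1, hvc⟩
        have hbB' : b ∈ B' := by
          by_contra h
          exact hv ⟨⟨a, ha.1, hva⟩, b, h, hvb⟩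
        refine hb ⟨hbB', fun hbc => ha.2 ?_⟩
        exact (hclosed e).2 b hbc a (hB'sub ha.1).1 v hB hvb hva
    -- Links inside a class use vertices outside `X.bd B`, so they cannot cross a bipartition whose
    -- boundaries lie in `X.bd B`.
    have hconn : X.InternallyConnected (cls e) := by
      refine ⟨⟨e, hself e heB₁.1⟩, ?_⟩
      rintro ⟨A₁, A₂, h₁, h₂, hun, hdis, hb₁, -⟩
      have hstep : ∀ a b, a ∈ A₁ → X.Link B (X.bd B)ᶜ a b → b ∈ A₁ := by
        rintro a b ha ⟨haB, hbB, v, hv, hva, hvb⟩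
        by_contra hb
        exact hv ((hclosed e).bd_subset (hb₁ ⟨⟨a, ha, hva⟩, b, hb, hvb⟩))
      obtain ⟨a, ha⟩ := h₁
      obtain ⟨b, hb⟩ := h₂
      have hae : a ∈ cls e := hun ▸ Or.inl ha
      have hbe : b ∈ cls e := hun ▸ Or.inr hb
      have hab : X.Linked B (X.bd B)ᶜ a b := hae.2.symm.trans hbe.2
      have key : ∀ c, X.Linked B (X.bd B)ᶜ a c → c ∈ A₁ := by
        intro c hc
        induction hc with
        | refl => exact ha
        | tail _ h ih => exact hstep _ _ ih h
      exact Set.disjoint_left.1 hdis (key b hab) hb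
    have heq : B' = cls e := Set.Subset.antisymm hB'cls (hmax ⟨hsub e heB₁, hconn⟩ hB'cls)
    rw [heq, heB₁.2, hbd e heB₁]

end MultiHypergraph

/-! ### Support hypergraphs and the adhesion bound -/

section Support

variable {V : Type u} (G : SimpleGraph V)

theorem connIn_of_mem_inc {e : V ⊕ G.edgeSet} {x y : V} (hx : x ∈ (supportHypergraph G).inc e)
    (hy : y ∈ (supportHypergraph G).inc e) : ConnIn G (∅ ∪ {x, y}) x y := by
  rcases e with z | ⟨e, he⟩
  · have hx' : x = z := hx
    have hy' : y = z := hy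
    subst hx'; subst hy'
    exact ConnIn.refl (by simp)
  · have hx' : x ∈ e := hx
    have hy' : y ∈ e := hy
    by_cases hxy : x = y
    · subst hxy
      exact ConnIn.refl (by simp)
    · rw [(Sym2.mem_and_mem_iff hxy).1 ⟨hx', hy'⟩] at he
      exact ConnIn.of_adj he (by simp) (by simp)

theorem primal_supportHypergraph : (supportHypergraph G).primal = G := by
  ext x y
  constructor
  · rintro ⟨hne, e | ⟨e, he⟩, hx, hy⟩
    · have hx' : x = e := hx
      have hy' : y = e := hy
      exact absurd (hx'.trans hy'.symm) hne
    · have hx' : x ∈ e := hx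
      have hy' : y ∈ e := hy
      rw [(Sym2.mem_and_mem_iff hne).1 ⟨hx', hy'⟩] at he
      exact he
  · intro h
    exact ⟨h.ne, Sum.inr ⟨s(x, y), h⟩, Sym2.mem_mk_left x y, Sym2.mem_mk_right x y⟩

variable {G}

/-- Two vertices of one hyperedge of the support hypergraph are equal or adjacent, so a sequence of
links through interior vertices is a walk of G. -/
theorem WellLinked.connIn [Finite V] {L : Set (V ⊕ G.edgeSet)}
    (hL : (supportHypergraph G).WellLinked L) {x y : V} (hx : x ∈ (supportHypergraph G).bd L)
    (hy : y ∈ (supportHypergraph G).bd L) :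
    ConnIn G ((supportHypergraph G).interior L ∪ {x, y}) x y := by
  obtain ⟨a, ha, b, -, hxa, hyb, hab⟩ := hL.exists_linked hx hy
  exact hab.connIn (J := fun _ => ∅) (S := (supportHypergraph G).interior L) (fun a _ x hx y hy => connIn_of_mem_inc G hx hy)
    (fun _ _ => Set.empty_subset _) (fun v hv a ha hva => ⟨⟨a, ha, hva⟩, hv⟩) ha hxa hyb

variable {N : Type w} [PartialOrder N] [OrderBot N] {X : Set V} {bag : N → Finset V} {w : ℕ}

theorem IsRootedDecomposition.exists_node [Finite V] (hd : IsRootedDecomposition G X bag w)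
    (e : V ⊕ G.edgeSet) : ∃ t, ∀ x ∈ (supportHypergraph G).inc e, x ∉ X → x ∈ bag t := by
  have hone : ∀ x : V, ∃ t, x ∉ X → x ∈ bag t := by
    intro x
    by_cases hx : x ∈ X
    · exact ⟨⊥, fun h => absurd hx h⟩
    · obtain ⟨t, ht, -⟩ := hd.isSubtree x hx
      exact ⟨t, fun _ => ht⟩
  rcases e with z | ⟨e, he⟩
  · obtain ⟨t, ht⟩ := hone z
    refine ⟨t, fun x hx hxX => ?_⟩
    have hx' : x = z := hx
    subst hx'
    exact ht hxX
  · induction e using Sym2.inductionOn with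
    | hf a b =>
      have hmem : ∀ x, x ∈ (supportHypergraph G).inc (Sum.inr ⟨s(a, b), he⟩) → x = a ∨ x = b :=
        fun x hx => Sym2.mem_iff.1 hx
      by_cases ha : a ∈ X
      · obtain ⟨t, ht⟩ := hone b
        refine ⟨t, fun x hx hxX => ?_⟩
        rcases hmem x hx with rfl | rfl
        · exact absurd ha hxX
        · exact ht hxX
      · by_cases hb : b ∈ X
        · obtain ⟨t, ht⟩ := hone a
          refine ⟨t, fun x hx hxX => ?_⟩
          rcases hmem x hx with rfl | rfl
          · exact ht hxX
          · exact absurd hb hxX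
        · obtain ⟨t, hta, htb⟩ := hd.adj a b ha hb he
          refine ⟨t, fun x hx _ => ?_⟩
          rcases hmem x hx with rfl | rfl
          · exact hta
          · exact htb

/-- A well-linked set with few vertices in a modulator, all of them on the boundary, has a small
boundary. -/
theorem WellLinked.lam_le [Finite V] [Finite N] (hN : IsForestOrder N)
    (hd : IsRootedDecomposition G X bag w) {L : Set (V ⊕ G.edgeSet)}
    (hL : (supportHypergraph G).WellLinked L)
    (hint : Disjoint ((supportHypergraph G).interior L) X) {m : ℕ}
    (hm : ((supportHypergraph G).bd L ∩ X).ncard ≤ m) :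
    (supportHypergraph G).lam L ≤ 6 * w + 2 + m := by
  have := Fintype.ofFinite V
  set H := supportHypergraph G with hH
  by_contra hlt
  set bL : Finset V := (H.bd L).toFinset with hbL
  have hlam : H.lam L = bL.card := Set.ncard_eq_toFinset_card' _
  set Y : Finset V := bL.filter fun v => v ∉ X with hY
  have hYc : 6 * w + 2 < Y.card := by
    have h1 : (bL.filter fun v => v ∈ X).card + Y.card = bL.card := by
      rw [hY]
      convert Finset.card_filter_add_card_filter_not (s := bL) (fun v => v ∈ X)
    have h2 : (bL.filter fun v => v ∈ X).card ≤ m := by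
      refine le_trans ?_ hm
      rw [Set.ncard_eq_toFinset_card']
      apply Finset.card_le_card
      intro v hv
      obtain ⟨h3, h4⟩ := Finset.mem_filter.1 hv
      rw [Set.mem_toFinset]
      exact ⟨Set.mem_toFinset.1 h3, h4⟩
    omega
  choose nd hnd using hd.exists_node
  have hτ : ∀ v : V, ∃ t, v ∉ X → v ∈ bag t := fun v => by
    obtain ⟨t, ht⟩ := hd.exists_node (Sum.inl v)
    exact ⟨t, fun hv => ht v rfl hv⟩
  choose τ hτ using hτ
  -- Both I and `Y \ I` have at least `2 * w + 1` vertices. So each side of the cut loses more than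
  -- w boundary vertices outside `bag t` and gains at most the w vertices of `bag t`.
  obtain ⟨t, D, I, hD, hIY, hI1, hI2, hI3, hI4⟩ := exists_split hN Y τ (W := 2 * w + 1) (by omega)
  have hiff : ∀ v, v ∉ X → v ∉ bag t → ∀ i j, v ∈ bag i → v ∈ bag j → i ∈ D → j ∈ D := by
    intro v hv hvt i j hi hj hiD
    exact hD.subset_of_mem hN (hd.isSubtree v hv) hvt (i := i) hi hiD hj
  set A : Set (V ⊕ G.edgeSet) := {e | e ∈ L ∧ nd e ∈ D} with hA
  have hbt := hd.card_le t
  -- An interior vertex of L avoids X, so outside `bag t` its bags lie on one side of the cut, and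
  -- it cannot become a boundary vertex.
  have hbdL : ∀ v, v ∉ bag t → ∀ a ∈ A, v ∈ H.inc a → ∀ b, b ∉ A → v ∈ H.inc b → v ∈ H.bd L := by
    intro v hvt a ha hva b hb hvb
    by_contra hv
    have hbL : b ∈ L := by
      by_contra h
      exact hv ⟨⟨a, ha.1, hva⟩, b, h, hvb⟩
    have hvX : v ∉ X := Set.disjoint_left.1 hint ⟨⟨a, ha.1, hva⟩, hv⟩
    exact hb ⟨hbL, hiff v hvX hvt _ _ (hnd a v hva hvX) (hnd b v hvb hvX) ha.2⟩
  have h1 : H.lam A < H.lam L := by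
    set K := (Y \ I) \ bag t with hK
    have hsub : H.bd A ⊆ (((bL \ K) ∪ bag t : Finset V) : Set V) := by
      rintro v ⟨⟨a, ha, hva⟩, b, hb, hvb⟩
      rw [Finset.mem_coe, Finset.mem_union]
      by_cases hvt : v ∈ bag t
      · exact Or.inr hvt
      left
      rw [Finset.mem_sdiff]
      refine ⟨Set.mem_toFinset.2 (hbdL v hvt a ha hva b hb hvb), fun hvK => ?_⟩
      obtain ⟨hvYI, -⟩ := Finset.mem_sdiff.1 hvK
      obtain ⟨hvY, hvI⟩ := Finset.mem_sdiff.1 hvYI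
      have hvX : v ∉ X := (Finset.mem_filter.1 hvY).2
      exact hvI (hI3 v hvY (hiff v hvX hvt _ _ (hnd a v hva hvX) (hτ v hvX) ha.2))
    have hKsub : K ⊆ bL := (Finset.sdiff_subset.trans Finset.sdiff_subset).trans
      (Finset.filter_subset _ _)
    have c1 := Set.ncard_le_ncard hsub (Set.toFinite _)
    rw [Set.ncard_coe_finset] at c1
    have c2 := Finset.card_union_le (bL \ K) (bag t)
    have c3 := Finset.card_sdiff_add_card_eq_card hKsub
    have c4 := Finset.le_card_sdiff (bag t) (Y \ I)
    rw [← hK] at c4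
    have c5 := Finset.le_card_sdiff I Y
    rw [hlam]
    change (H.bd A).ncard < _
    omega
  have h2 : H.lam (L \ A) < H.lam L := by
    set K := I \ bag t with hK
    have hsub : H.bd (L \ A) ⊆ (((bL \ K) ∪ bag t : Finset V) : Set V) := by
      rintro v ⟨⟨a, ha, hva⟩, b, hb, hvb⟩
      rw [Finset.mem_coe, Finset.mem_union]
      by_cases hvt : v ∈ bag t
      · exact Or.inr hvt
      left
      rw [Finset.mem_sdiff]
      constructor
      · rw [hbL, Set.mem_toFinset]
        by_cases hbA : b ∈ A
        · exact hbdL v hvt b hbA hvb a ha.2 hva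
        · exact ⟨⟨a, ha.1, hva⟩, b, fun h => hb ⟨h, hbA⟩, hvb⟩
      · intro hvK
        obtain ⟨hvI, -⟩ := Finset.mem_sdiff.1 hvK
        have hvX : v ∉ X := (Finset.mem_filter.1 (hIY hvI)).2
        have hτD : τ v ∈ D := by
          rcases hI4 v hvI with h | h
          · exact h
          · exact absurd (h ▸ hτ v hvX) hvt
        exact ha.2 ⟨ha.1, hiff v hvX hvt _ _ (hτ v hvX) (hnd a v hva hvX) hτD⟩
    have hKsub : K ⊆ bL := (Finset.sdiff_subset.trans hIY).trans (Finset.filter_subset _ _)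
    have c1 := Set.ncard_le_ncard hsub (Set.toFinite _)
    rw [Set.ncard_coe_finset] at c1
    have c2 := Finset.card_union_le (bL \ K) (bag t)
    have c3 := Finset.card_sdiff_add_card_eq_card hKsub
    have c4 := Finset.le_card_sdiff (bag t) I
    rw [← hK] at c4
    rw [hlam]
    change (H.bd (L \ A)).ncard < _
    omega
  rcases hL A (L \ A) (Set.union_sdiff_cancel fun e he => he.1) disjoint_sdiff_self_right with
    h | h <;> omega

end Support

end Hypergraph

end Mergeable

namespace Mergeable

/-! ### Linked systems and tree decompositions of the torso -/

section Torso

open scoped Classical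

universe u v w

/-- A subtree that avoids a set of nodes closed under lowest common ancestors is separated from it
by at most two of its nodes. -/
theorem exists_separating_nodes {N : Type u} [PartialOrder N] (hN : IsForestOrder N) {Z : Finset N}
    (hZ : ∀ x ∈ Z, ∀ y ∈ Z, ∃ l ∈ Z, IsLCA l x y) {F : Set N} (hF : IsSubtree F)
    (hFZ : ∀ z ∈ Z, z ∉ F) :
    ∃ P : Finset N, P.card ≤ 2 ∧ ∀ K : Set N, IsSubtree K → (K ∩ F).Nonempty →
      (∃ z ∈ Z, z ∈ K) → ∃ p ∈ P, p ∈ K := by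
  obtain ⟨τ, hτ, hF⟩ := hF
  -- The last node of Z below the root τ of F, if there is one.
  set P₁ : Finset N := Z.filter fun z => z ≤ τ ∧ ∀ y ∈ Z, y ≤ τ → y ≤ z with hP₁
  -- A first node of Z not below τ that branches off beyond all nodes of Z below τ. Two such nodes
  -- have their meet in Z; it lies beyond those nodes, so it is not below τ, and by minimality it
  -- equals both.
  set P₂ : Finset N := Z.filter fun z => ¬ z ≤ τ ∧ (∀ y ∈ Z, y ≤ z → y = z ∨ y ≤ τ) ∧
    ∃ b, b ≤ z ∧ b ≤ τ ∧ ∀ y ∈ Z, y ≤ τ → y < b with hP₂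
  have h₁ : P₁.card ≤ 1 := by
    refine Finset.card_le_one.2 fun a ha b hb => ?_
    simp only [hP₁, Finset.mem_filter] at ha hb
    exact le_antisymm (hb.2.2 a ha.1 ha.2.1) (ha.2.2 b hb.1 hb.2.1)
  have h₂ : P₂.card ≤ 1 := by
    refine Finset.card_le_one.2 fun a ha b hb => ?_
    simp only [hP₂, Finset.mem_filter] at ha hb
    obtain ⟨haZ, haτ, ham, c, hca, hcτ, hc⟩ := ha
    obtain ⟨hbZ, hbτ, hbm, d, hdb, hdτ, hd⟩ := hb
    obtain ⟨l, hlZ, hla, hlb, hl⟩ := hZ a haZ b hbZ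
    rcases ham l hlZ hla with h | h
    · subst h
      rcases hbm l hlZ hlb with h | h
      · exact h
      · exact absurd h haτ
    · rcases hN c d τ hcτ hdτ with hcd | hcd
      · exact absurd (hl c hca (hcd.trans hdb)) (hc l hlZ h).not_ge
      · exact absurd (hl d (hcd.trans hca) hdb) (hd l hlZ h).not_ge
  refine ⟨P₁ ∪ P₂, (Finset.card_union_le _ _).trans (by omega), ?_⟩
  rintro K hK ⟨f, hfK, hfF⟩ ⟨z, hz, hzK⟩
  have hK' := hK
  obtain ⟨κ, hκ, hKτ⟩ := hK
  have hκf := (hKτ f hfK).1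
  have hτf := (hF f hfF).1
  have hκz := (hKτ z hzK).1
  have hmin : ¬ z ≤ τ → ∃ y₀ ∈ Z, y₀ ≤ z ∧ ¬ y₀ ≤ τ ∧ ∀ y ∈ Z, y ≤ y₀ → y = y₀ ∨ y ≤ τ := by
    intro hzτ
    obtain ⟨y₀, hy₀⟩ := (Z.filter fun y => y ≤ z ∧ ¬ y ≤ τ).exists_minimal
      ⟨z, Finset.mem_filter.2 ⟨hz, le_rfl, hzτ⟩⟩
    obtain ⟨hy₀m, hy₀min⟩ := hy₀
    obtain ⟨hy₀Z, hy₀z, hy₀τ⟩ := Finset.mem_filter.1 hy₀m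
    refine ⟨y₀, hy₀Z, hy₀z, hy₀τ, fun y hy hyy => ?_⟩
    by_cases hyτ : y ≤ τ
    · exact Or.inr hyτ
    · exact Or.inl (le_antisymm hyy
        (hy₀min (Finset.mem_filter.2 ⟨hy, hyy.trans hy₀z, hyτ⟩) hyy))
  by_cases hκτ : κ ≤ τ
  · by_cases hex : ∃ y ∈ Z, κ ≤ y ∧ y ≤ τ
    · obtain ⟨y, hy, hκy, hyτ⟩ := hex
      obtain ⟨m, hm⟩ := (Z.filter fun y => y ≤ τ).exists_maximal
        ⟨y, Finset.mem_filter.2 ⟨hy, hyτ⟩⟩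
      obtain ⟨hm1, hmax⟩ := hm
      obtain ⟨hmZ, hmτ⟩ := Finset.mem_filter.1 hm1
      have hle : ∀ x ∈ Z, x ≤ τ → x ≤ m := by
        intro x hx hxτ
        rcases hN _ _ _ hxτ hmτ with h | h
        · exact h
        · exact hmax (Finset.mem_filter.2 ⟨hx, hxτ⟩) h
      refine ⟨m, Finset.mem_union_left _ (Finset.mem_filter.2 ⟨hmZ, hmτ, hle⟩), ?_⟩
      exact (hKτ f hfK).2 m (hκy.trans (hle y hy hyτ)) (hmτ.trans hτf)
    · push Not at hex
      obtain ⟨y₀, hy₀Z, hy₀z, hy₀τ, hy₀⟩ := hmin (hex z hz hκz)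
      have hκy₀ : κ ≤ y₀ := by
        rcases hN _ _ _ hκz hy₀z with h | h
        · exact h
        · exact absurd (h.trans hκτ) hy₀τ
      refine ⟨y₀, Finset.mem_union_right _ (Finset.mem_filter.2 ⟨hy₀Z, hy₀τ, hy₀, κ, hκy₀, hκτ,
        fun y hy hyτ => ?_⟩), (hKτ z hzK).2 y₀ hκy₀ hy₀z⟩
      rcases hN _ _ _ hyτ hκτ with h | h
      · refine lt_of_le_of_ne h ?_
        rintro rfl
        exact hex y hy le_rfl hyτ
      · exact absurd hyτ (hex y hy h)
  · have hτκ : τ ≤ κ := (hN _ _ _ hκf hτf).resolve_left hκτ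
    have hzτ : ¬ z ≤ τ := fun h => hκτ (hκz.trans h)
    obtain ⟨y₀, hy₀Z, hy₀z, hy₀τ, hy₀⟩ := hmin hzτ
    have hκy₀ : κ ≤ y₀ := by
      rcases hN _ _ _ hκz hy₀z with h | h
      · exact h
      · rcases hN _ _ _ h hτκ with h' | h'
        · exact absurd h' hy₀τ
        · exact absurd ((hF f hfF).2 y₀ h' (h.trans hκf)) (hFZ y₀ hy₀Z)
    refine ⟨y₀, Finset.mem_union_right _ (Finset.mem_filter.2 ⟨hy₀Z, hy₀τ, hy₀, τ,
      hτκ.trans hκy₀, le_rfl, fun y hy hyτ => ?_⟩), (hKτ z hzK).2 y₀ hκy₀ hy₀z⟩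
    refine lt_of_le_of_ne hyτ ?_
    rintro rfl
    exact hFZ y hy hτ

variable {V : Type u} {ι : Type v}

/-- The vertices of each hyperedge `i` are connected in `G` through a set `J i`; these sets are
pairwise disjoint and contain no vertices of hyperedges. -/
structure IsLinkedSystem (G : SimpleGraph V) (T : MultiHypergraph V ι) (J : ι → Set V) : Prop where
  disjoint : ∀ i j, i ≠ j → Disjoint (J i) (J j)
  notMem : ∀ i j, ∀ x ∈ T.inc j, x ∉ J i
  conn : ∀ i, ∀ x ∈ T.inc i, ∀ y ∈ T.inc i, ConnIn G (J i ∪ {x, y}) x y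

variable {G : SimpleGraph V} {T : MultiHypergraph V ι} {J : ι → Set V}

/-- Disjoint linked sets of hyperedges form an attached family. -/
theorem IsLinkedSystem.isAttachedFamily [Finite V] (hS : IsLinkedSystem G T J) (Y : Finset V)
    {κ : Type w} (c : κ → Set ι) (O : κ → Set V) (hJY : ∀ j, ∀ i ∈ c j, ∀ y ∈ Y, y ∉ J i)
    (hOY : ∀ j, ∀ y ∈ Y, y ∉ O j) (hOc : ∀ j, O j ⊆ T.verts (c j))
    (hcd : ∀ j j', j ≠ j' → Disjoint (c j) (c j')) (hOd : ∀ j j', j ≠ j' → Disjoint (O j) (O j'))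
    (hl : ∀ j, ∀ a ∈ c j, ∀ b ∈ c j, T.Linked (c j) (O j) a b) :
    IsAttachedFamily G Y (fun j => (Set.toFinite (T.verts (c j) ∩ Y)).toFinset)
      (fun j => O j ∪ ⋃ i ∈ c j, J i) := by
  have hOJ : ∀ j j', ∀ v ∈ O j, v ∉ ⋃ i ∈ c j', J i := by
    intro j j' v hv hv'
    obtain ⟨i, -, hvi⟩ := Set.mem_iUnion₂.1 hv'
    obtain ⟨i', -, hvi'⟩ := hOc j hv
    exact hS.notMem i i' v hvi' hvi
  refine ⟨?_, ?_, ?_, ?_⟩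
  · intro j x hx
    rw [Set.Finite.mem_toFinset] at hx
    exact hx.2
  · intro j j' hjj
    rw [Set.disjoint_left]
    rintro v (hv | hv) (hv' | hv')
    · exact Set.disjoint_left.1 (hOd j j' hjj) hv hv'
    · exact hOJ j j' v hv hv'
    · exact hOJ j' j v hv' hv
    · obtain ⟨i, hi, hvi⟩ := Set.mem_iUnion₂.1 hv
      obtain ⟨i', hi', hvi'⟩ := Set.mem_iUnion₂.1 hv'
      have hne : i ≠ i' := by
        rintro rfl
        exact Set.disjoint_left.1 (hcd j j' hjj) hi hi'
      exact Set.disjoint_left.1 (hS.disjoint i i' hne) hvi hvi'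
  · rintro j y hy (h | h)
    · exact hOY j y hy h
    · obtain ⟨i, hi, hyi⟩ := Set.mem_iUnion₂.1 h
      exact hJY j i hi y hy hyi
  · intro j x hx y hy _
    rw [Set.Finite.mem_toFinset] at hx hy
    obtain ⟨⟨a, ha, hxa⟩, -⟩ := hx
    obtain ⟨⟨b, hb, hyb⟩, -⟩ := hy
    refine (hl j a ha b hb).connIn (J := J) (fun i _ => hS.conn i) ?_ ?_ ha hxa hyb
    · exact fun i hi => (Set.subset_biUnion_of_mem (u := J) hi).trans Set.subset_union_right
    · exact fun v hv i hi _ => Or.inl hv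

variable {N : Type w} [PartialOrder N] [OrderBot N] [Finite N]

/-- Bags at the nodes of a rooted tree such that the vertices outside `R` of every hyperedge
`i ∈ E` lie in the bag of the node `node i`. -/
structure IsHyperDecomposition (T : MultiHypergraph V ι) (E : Set ι) (R : Set V)
    (bag : N → Finset V) (node : ι → N) (w : ℕ) : Prop where
  card_le : ∀ t, (bag t).card ≤ w
  isSubtree : ∀ x ∉ R, IsSubtree {t | x ∈ bag t}
  mem_node : ∀ i ∈ E, ∀ x ∈ T.inc i, x ∉ R → x ∈ bag (node i)

/-- A rooted decomposition of `G` outside `X` yields one of the hypergraph. -/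
theorem IsLinkedSystem.exists_hyperDecomposition [Finite V] (hS : IsLinkedSystem G T J)
    (hN : IsForestOrder N) {X R : Set V} {bag : N → Finset V} {w d : ℕ}
    (hd : IsRootedDecomposition G X bag w) (hXR : X ⊆ R) {E : Set ι}
    (hJX : ∀ i ∈ E, Disjoint (J i) X) (hE : ∀ i ∈ E, (T.inc i).ncard ≤ d) :
    ∃ (bag' : N → Finset V) (node : ι → N),
      IsHyperDecomposition T E R bag' node (w * (d + 1)) := by
  have := Fintype.ofFinite V
  -- `O x` enlarges x by what it reaches inside the connecting sets of its hyperedges. The new bags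
  -- contain x at every node where an old bag meets `O x`.
  set O : V → Set V := fun x => {y | y = x ∨ ∃ i ∈ E, x ∈ T.inc i ∧ y ∈ J i ∧
    ConnIn G (J i ∪ {x}) x y} with hO
  set F : V → Set N := fun x => ⋃ y ∈ O x, {t | y ∈ bag t} with hF
  have hmemF : ∀ x t, t ∈ F x ↔ ∃ y ∈ O x, y ∈ bag t := by
    intro x t
    simp [hF]
  have hOX : ∀ x, x ∉ R → ∀ y ∈ O x, y ∉ X := by
    rintro x hx y (rfl | ⟨i, hi, -, hy, -⟩)
    · exact fun h => hx (hXR h)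
    · exact Set.disjoint_left.1 (hJX i hi) hy
  have hreach : ∀ (S : Set V) (x y : V), x ∈ S → ConnIn G S x y →
      Relation.ReflTransGen (fun a b => a ∈ S ∧ b ∈ S ∧ G.Adj a b) x y := by
    rintro S x y hx ⟨p, hp⟩
    induction p with
    | nil => exact Relation.ReflTransGen.refl
    | cons hadj q ih =>
      have h1 := hp _ (List.mem_cons_of_mem _ q.start_mem_support)
      exact Relation.ReflTransGen.head ⟨hx, h1, hadj⟩
        (ih h1 fun v hv => hp v (List.mem_cons_of_mem _ hv))
  have hFsub : ∀ x ∉ R, IsSubtree (F x) := by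
    intro x hx
    refine IsSubtree.biUnion_of_linked hN (fun y hy => hd.isSubtree y (hOX x hx y hy)) x
      (Or.inl rfl) ?_
    rintro y (rfl | ⟨i, hi, hxi, hy, hc⟩)
    · exact Relation.ReflTransGen.refl
    · have key : ∀ z, Relation.ReflTransGen (fun a b => a ∈ J i ∪ {x} ∧ b ∈ J i ∪ {x} ∧
          G.Adj a b) x z → ConnIn G (J i ∪ {x}) x z ∧ z ∈ O x ∧ Relation.ReflTransGen
          (fun a b => b ∈ O x ∧ ({t | a ∈ bag t} ∩ {t | b ∈ bag t}).Nonempty) x z := by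
        intro z hz
        induction hz with
        | refl => exact ⟨ConnIn.refl (by simp), Or.inl rfl, Relation.ReflTransGen.refl⟩
        | @tail b c _ hbc ih =>
          obtain ⟨h1, h2, h3⟩ := ih
          have h4 := h1.trans (ConnIn.of_adj hbc.2.2 hbc.1 hbc.2.1)
          have h5 : c ∈ O x := by
            rcases hbc.2.1 with h | h
            · exact Or.inr ⟨i, hi, hxi, h, h4⟩
            · exact Or.inl h
          obtain ⟨t, htb, htc⟩ := hd.adj b c (hOX x hx b h2) (hOX x hx c h5) hbc.2.2
          exact ⟨h4, h5, h3.tail ⟨h5, t, htb, htc⟩⟩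
      exact (key y (hreach _ _ _ (by simp) hc)).2.2
  -- On a walk from x to y through `J i`, the vertex before the first visit to y lies in `O x` and
  -- shares a bag with y.
  have hpair : ∀ i ∈ E, ∀ x ∈ T.inc i, ∀ y ∈ T.inc i, x ∉ R → y ∉ R → (F x ∩ F y).Nonempty := by
    intro i hi x hx y hy hxR hyR
    have key : ∀ z, Relation.ReflTransGen (fun a b => a ∈ J i ∪ {x, y} ∧ b ∈ J i ∪ {x, y} ∧
        G.Adj a b) x z → (F x ∩ F y).Nonempty ∨
          (z ∈ J i ∪ {x} ∧ ConnIn G (J i ∪ {x}) x z) := by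
      intro z hz
      induction hz with
      | refl => exact Or.inr ⟨by simp, ConnIn.refl (by simp)⟩
      | @tail b c _ hbc ih =>
        rcases ih with ih | ⟨hb, hxb⟩
        · exact Or.inl ih
        have hc : c ∈ J i ∪ {x} ∨ c = y := by
          rcases hbc.2.1 with h | h | h
          · exact Or.inl (Or.inl h)
          · exact Or.inl (Or.inr h)
          · exact Or.inr h
        rcases hc with hc | rfl
        · exact Or.inr ⟨hc, hxb.trans (ConnIn.of_adj hbc.2.2 hb hc)⟩
        · left
          have hbO : b ∈ O x := by
            rcases hb with h | h
            · exact Or.inr ⟨i, hi, hx, h, hxb⟩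
            · exact Or.inl h
          obtain ⟨t, htb, htc⟩ := hd.adj b c (hOX x hxR b hbO) (fun h => hyR (hXR h)) hbc.2.2
          exact ⟨t, (hmemF x t).2 ⟨b, hbO, htb⟩, (hmemF c t).2 ⟨c, Or.inl rfl, htc⟩⟩
    rcases key y (hreach _ _ _ (by simp) (hS.conn i x hx y hy)) with h | ⟨h | h, -⟩
    · exact h
    · exact absurd h (hS.notMem i i y hy)
    · obtain ⟨t, ht, -⟩ := hFsub x hxR
      have h' : y = x := h
      exact ⟨t, ht, h' ▸ ht⟩
  have hnode : ∀ i, ∃ t, i ∈ E → ∀ x ∈ T.inc i, x ∉ R → t ∈ F x := by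
    intro i
    by_cases hi : i ∈ E
    · rcases (T.inc i \ R).eq_empty_or_nonempty with h | h
      · refine ⟨⊥, fun _ x hx hxR => ?_⟩
        have : x ∈ T.inc i \ R := ⟨hx, hxR⟩
        rw [h] at this
        exact absurd this (Set.notMem_empty x)
      · obtain ⟨t, ht⟩ := exists_mem_of_pairwise_inter hN h (F := F)
          (fun x hx => hFsub x hx.2) (fun x hx y hy => hpair i hi x hx.1 y hy.1 hx.2 hy.2)
        exact ⟨t, fun _ x hx hxR => ht x ⟨hx, hxR⟩⟩
    · exact ⟨⊥, fun h => absurd h hi⟩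
  choose node hnode using hnode
  refine ⟨fun t => Finset.univ.filter fun x => x ∉ R ∧ t ∈ F x, node, ?_, ?_, ?_⟩
  · intro t
    have hsub : (Finset.univ.filter fun x => x ∉ R ∧ t ∈ F x) ⊆
        (bag t).biUnion fun y => Finset.univ.filter fun x => y ∈ O x := by
      intro x hx
      obtain ⟨y, hy, hyt⟩ := (hmemF x t).1 (Finset.mem_filter.1 hx).2.2
      exact Finset.mem_biUnion.2 ⟨y, hyt, Finset.mem_filter.2 ⟨Finset.mem_univ _, hy⟩⟩
    refine (Finset.card_le_card hsub).trans ?_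
    -- A vertex y lies in `O y`. As the `J i` are disjoint, it otherwise lies only in `O x` for the
    -- at most d vertices x of a single hyperedge.
    refine (Finset.card_biUnion_le_card_mul _ _ (d + 1) fun y _ => ?_).trans
      (Nat.mul_le_mul_right _ (hd.card_le t))
    by_cases hex : ∃ i ∈ E, y ∈ J i
    · obtain ⟨i, hi, hyi⟩ := hex
      have hsub' : (Finset.univ.filter fun x => y ∈ O x) ⊆ insert y (T.inc i).toFinset := by
        intro x hx
        rw [Finset.mem_insert, Set.mem_toFinset]
        rcases (Finset.mem_filter.1 hx).2 with h | ⟨j, hj, hxj, hyj, -⟩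
        · exact Or.inl h.symm
        · right
          have : i = j := by
            by_contra hne
            exact Set.disjoint_left.1 (hS.disjoint i j hne) hyi hyj
          rwa [this]
      refine (Finset.card_le_card hsub').trans ((Finset.card_insert_le _ _).trans ?_)
      rw [← Set.ncard_eq_toFinset_card']
      exact Nat.add_le_add_right (hE i hi) 1
    · have hsub' : (Finset.univ.filter fun x => y ∈ O x) ⊆ {y} := by
        intro x hx
        rw [Finset.mem_singleton]
        rcases (Finset.mem_filter.1 hx).2 with h | ⟨j, hj, -, hyj, -⟩
        · exact h.symm
        · exact absurd ⟨j, hj, hyj⟩ hex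
      refine (Finset.card_le_card hsub').trans ?_
      simp
  · intro x hx
    have : {t | x ∈ Finset.univ.filter fun x => x ∉ R ∧ t ∈ F x} = F x := by
      ext t
      simp [hx]
    rw [this]
    exact hFsub x hx
  · intro i hi x hx hxR
    exact Finset.mem_filter.2 ⟨Finset.mem_univ _, hxR, hnode i hi x hx hxR⟩

end Torso

end Mergeable

namespace Mergeable

/-! ### Link classes, their attachments, and a small boundary -/

section Attachments

open scoped Classical

universe u v w

variable {V : Type u} {ι : Type v} {G : SimpleGraph V} {T : MultiHypergraph V ι} {J : ι → Set V}

/-- The hyperedges of `E` that are linked to `i` outside `R`. -/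
def MultiHypergraph.linkClass (T : MultiHypergraph V ι) (E : Set ι) (R : Set V) (i : ι) : Set ι :=
  {j | T.Linked E Rᶜ i j}

namespace MultiHypergraph

variable {E : Set ι} {R : Set V} {i j : ι}

theorem self_mem_linkClass : i ∈ T.linkClass E R i := Relation.ReflTransGen.refl

theorem linkClass_subset (hi : i ∈ E) : T.linkClass E R i ⊆ E := fun _ hj => Linked.mem hi hj

theorem linkClass_eq (h : j ∈ T.linkClass E R i) : T.linkClass E R j = T.linkClass E R i :=
  Set.ext fun _ => ⟨fun hk => Linked.trans h hk, fun hk => Linked.trans (Linked.symm h) hk⟩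

theorem mem_linkClass_of_mem (hi : i ∈ E) (hj : j ∈ E) {x : V} (hx : x ∉ R) (hxi : x ∈ T.inc i)
    (hxj : x ∈ T.inc j) : j ∈ T.linkClass E R i :=
  Relation.ReflTransGen.single ⟨hi, hj, x, hx, hxi, hxj⟩

/-- A sequence of links from i never leaves the class of i, so the links can be restricted to it.
This lets a class serve as a member of an attached family. -/
theorem linked_linkClass {a b : ι} (ha : a ∈ T.linkClass E R i) (hb : b ∈ T.linkClass E R i) :
    T.Linked (T.linkClass E R i) (T.verts (T.linkClass E R i) \ R) a b := by
  have key : ∀ c, T.Linked E Rᶜ i c →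
      T.Linked (T.linkClass E R i) (T.verts (T.linkClass E R i) \ R) i c := by
    intro c hc
    induction hc with
    | refl => exact Relation.ReflTransGen.refl
    | @tail b c hb h ih =>
      have hcl : c ∈ T.linkClass E R i := Relation.ReflTransGen.tail hb h
      obtain ⟨-, -, v, hv, hvb, hvc⟩ := h
      exact ih.tail ⟨hb, hcl, v, ⟨⟨c, hcl, hvc⟩, hv⟩, hvb, hvc⟩
  exact (key a ha).symm.trans (key b hb)

theorem exists_mem_of_mem_linkClass (h : (T.verts (T.linkClass E R i) \ R).Nonempty) {g : ι}
    (hg : g ∈ T.linkClass E R i) : ∃ v ∈ T.verts (T.linkClass E R i) \ R, v ∈ T.inc g := by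
  obtain ⟨v, ⟨a, ha, hva⟩, hvR⟩ := h
  rcases Relation.ReflTransGen.cases_head (linked_linkClass hg ha) with rfl | ⟨b, h, -⟩
  · exact ⟨v, ⟨⟨g, ha, hva⟩, hvR⟩, hva⟩
  · obtain ⟨-, -, v, hv, hvg, -⟩ := h
    exact ⟨v, hv, hvg⟩

theorem linkClass_eq_singleton (h : T.verts (T.linkClass E R i) \ R = ∅) :
    T.linkClass E R i = {i} := by
  refine Set.Subset.antisymm (fun j hj => ?_) (Set.singleton_subset_iff.2 self_mem_linkClass)
  rcases Relation.ReflTransGen.cases_tail (linked_linkClass self_mem_linkClass hj) with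
    h' | ⟨b, -, h'⟩
  · exact h'
  · obtain ⟨-, -, v, hv, -⟩ := h'
    rw [h] at hv
    exact absurd hv (Set.notMem_empty v)

end MultiHypergraph

variable {N : Type w} [PartialOrder N] [OrderBot N] [Finite N]

omit [OrderBot N] in
/-- The bags that meet the vertex set through which a set of hyperedges is linked form a
subtree. -/
theorem IsHyperDecomposition.isSubtree_biUnion (hN : IsForestOrder N) {E : Set ι} {R : Set V}
    {bag : N → Finset V} {node : ι → N} {w : ℕ} (hd : IsHyperDecomposition T E R bag node w)
    {c : Set ι} {O : Set V} (hcE : c ⊆ E) (hO : O ⊆ T.verts c) (hOR : Disjoint O R)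
    (hne : O.Nonempty) (hc : ∀ g ∈ c, ∃ v ∈ O, v ∈ T.inc g)
    (hl : ∀ a ∈ c, ∀ b ∈ c, T.Linked c O a b) : IsSubtree (⋃ v ∈ O, {t | v ∈ bag t}) := by
  have hOR' : ∀ v ∈ O, v ∉ R := fun v hv => Set.disjoint_left.1 hOR hv
  set F : ι → Set N := fun g => ⋃ v ∈ O ∩ T.inc g, {t | v ∈ bag t} with hF
  have hnode : ∀ g ∈ c, ∀ v ∈ O, v ∈ T.inc g → v ∈ bag (node g) := fun g hg v hv hvg =>
    hd.mem_node g (hcE hg) v hvg (hOR' v hv)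
  have hnF : ∀ g ∈ c, node g ∈ F g := by
    intro g hg
    obtain ⟨v, hv, hvg⟩ := hc g hg
    exact Set.mem_biUnion (show v ∈ O ∩ T.inc g from ⟨hv, hvg⟩) (hnode g hg v hv hvg)
  have heq : (⋃ v ∈ O, {t | v ∈ bag t}) = ⋃ g ∈ c, F g := by
    ext t
    simp only [hF, Set.mem_iUnion]
    constructor
    · rintro ⟨v, hv, ht⟩
      obtain ⟨g, hg, hvg⟩ := hO hv
      exact ⟨g, hg, v, ⟨hv, hvg⟩, ht⟩
    · rintro ⟨g, -, v, hv, ht⟩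
      exact ⟨v, hv.1, ht⟩
  obtain ⟨v₀, hv₀⟩ := hne
  obtain ⟨g₀, hg₀, -⟩ := hO hv₀
  rw [heq]
  refine IsSubtree.biUnion_of_linked hN (fun g hg => ?_) g₀ hg₀ fun g hg => ?_
  · obtain ⟨v, hv, hvg⟩ := hc g hg
    exact IsSubtree.biUnion_of_mem hN ⟨v, hv, hvg⟩ (fun v hv => hd.isSubtree v (hOR' v hv.1))
      (node g) fun v hv => hnode g hg v hv.1 hv.2
  · have := hl g₀ hg₀ g hg
    refine Relation.ReflTransGen.mono (fun a b hab => ?_) _ _ this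
    obtain ⟨ha, hb, v, hv, hva, hvb⟩ := hab
    refine ⟨hb, node a, hnF a ha, ?_⟩
    exact Set.mem_biUnion (show v ∈ O ∩ T.inc b from ⟨hv, hvb⟩) (hnode a ha v hv hva)

/-- The set `R` can be enlarged by a constant factor such that all classes of linked hyperedges
have few vertices in it. -/
theorem IsLinkedSystem.exists_small_attachments [Finite V] [Finite ι] (hS : IsLinkedSystem G T J)
    (hN : IsForestOrder N) {E : Set ι} {R : Finset V} {bag : N → Finset V} {node : ι → N}
    {w : ℕ} (hd : IsHyperDecomposition T E (R : Set V) bag node w) {r d : ℕ}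
    (hG : ¬ HasCliqueModel G r) (hJR : ∀ i ∈ E, ∀ y ∈ R, y ∉ J i)
    (hE : ∀ i ∈ E, (T.inc i).ncard ≤ d) :
    ∃ R₀ : Finset V, R ⊆ R₀ ∧ R₀.card ≤ (1 + 2 * maderBound r * w) * R.card ∧
      (∀ i ∈ E, ∀ y ∈ R₀, y ∉ J i) ∧
      ∀ i ∈ E, (T.verts (T.linkClass E R₀ i) ∩ R₀).ncard ≤ d + r + 2 * w := by
  have := Fintype.ofFinite V
  have := Fintype.ofFinite ι
  set good : Set ι × Set V → Prop := fun j => j.1 ⊆ E ∧ j.2 ⊆ T.verts j.1 ∧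
    Disjoint j.2 (R : Set V) ∧ j.2.Nonempty ∧ (∀ g ∈ j.1, ∃ v ∈ j.2, v ∈ T.inc g) ∧
    (∀ a ∈ j.1, ∀ b ∈ j.1, T.Linked j.1 j.2 a b) with hgood
  set F : Set ι × Set V → Set N := fun j => ⋃ v ∈ j.2, {t | v ∈ bag t} with hF
  have hFsub : ∀ j, good j → IsSubtree (F j) := by
    rintro j ⟨h1, h2, h3, h4, h5, h6⟩
    exact hd.isSubtree_biUnion hN h1 h2 h3 h4 h5 h6
  -- The obstructions: linked sets with at least r vertices in R. Those with disjoint subtrees form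
  -- an attached family, so a packing, and hence a hitting set, is linear in |R|.
  set s : Finset (Set ι × Set V) := Finset.univ.filter fun j =>
    good j ∧ r ≤ (T.verts j.1 ∩ R).ncard with hs
  obtain ⟨s', hs', Z₀, hdis, hZ₀, hhit⟩ := exists_disjoint_hitting hN (F := F) s
    fun j hj => hFsub j (Finset.mem_filter.1 hj).2.1
  have hg : ∀ j ∈ s', good j := fun j hj => (Finset.mem_filter.1 (hs' hj)).2.1
  have hs'c : s'.card ≤ maderBound r * R.card := by
    have hfam := hS.isAttachedFamily R (κ := s') (fun j => j.1.1) (fun j => j.1.2)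
      (fun j i hi => hJR i ((hg j j.2).1 hi))
      (fun j y hy h => Set.disjoint_left.1 (hg j j.2).2.2.1 h hy)
      (fun j => (hg j j.2).2.1) ?_ ?_ (fun j => (hg j j.2).2.2.2.2.2)
    · have := hfam.card_le_of_le_card hG Finset.univ fun j _ => by
        rw [← Set.ncard_eq_toFinset_card]
        exact (Finset.mem_filter.1 (hs' j.2)).2.2
      simpa using this
    · intro j j' hjj
      rw [Set.disjoint_left]
      intro g hgj hgj'
      have hmem : ∀ j : s', g ∈ j.1.1 → node g ∈ F j.1 := by
        intro j hgj
        obtain ⟨v, hv, hvg⟩ := (hg j j.2).2.2.2.2.1 g hgj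
        exact Set.mem_biUnion hv (hd.mem_node g ((hg j j.2).1 hgj) v hvg
          (Set.disjoint_left.1 (hg j j.2).2.2.1 hv))
      exact Set.disjoint_left.1 (hdis j j.2 j' j'.2 fun h => hjj (Subtype.ext h))
        (hmem j hgj) (hmem j' hgj')
    · intro j j' hjj
      rw [Set.disjoint_left]
      intro v hv hv'
      obtain ⟨t, ht, -⟩ := hd.isSubtree v (Set.disjoint_left.1 (hg j j.2).2.2.1 hv)
      exact Set.disjoint_left.1 (hdis j j.2 j' j'.2 fun h => hjj (Subtype.ext h))
        (Set.mem_biUnion hv ht) (Set.mem_biUnion hv' ht)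
  obtain ⟨Z, hZ₀Z, hZc, hZ⟩ := exists_lca_closure hN Z₀
  -- Only vertices of hyperedges are taken from the bags, as these avoid all the sets `J i`.
  set M : Finset V := (Z.biUnion bag).filter fun x => ∃ i, x ∈ T.inc i with hM
  have hMc : M.card ≤ 2 * (maderBound r * R.card) * w := by
    refine (Finset.card_filter_le _ _).trans ?_
    refine (Finset.card_biUnion_le_card_mul _ _ w fun t _ => hd.card_le t).trans ?_
    exact Nat.mul_le_mul_right _ (by omega)
  refine ⟨R ∪ M, Finset.subset_union_left, ?_, ?_, ?_⟩
  · calc (R ∪ M).card ≤ R.card + M.card := Finset.card_union_le _ _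
      _ ≤ R.card + 2 * (maderBound r * R.card) * w := by omega
      _ = _ := by ring
  · intro i hi y hy
    rcases Finset.mem_union.1 hy with h | h
    · exact hJR i hi y h
    · obtain ⟨j, hj⟩ := (Finset.mem_filter.1 h).2
      exact hS.notMem i j y hj
  · intro i hi
    set c := T.linkClass E ((R ∪ M : Finset V) : Set V) i with hc
    have hcE : c ⊆ E := MultiHypergraph.linkClass_subset hi
    rcases (T.verts c \ ((R ∪ M : Finset V) : Set V)).eq_empty_or_nonempty with hO | hO
    · have h1 : c = {i} := MultiHypergraph.linkClass_eq_singleton hO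
      have h2 : T.verts c ∩ ((R ∪ M : Finset V) : Set V) ⊆ T.inc i := by
        rintro v ⟨⟨a, ha, hva⟩, -⟩
        rw [h1] at ha
        have ha' : a = i := ha
        exact ha' ▸ hva
      have := Set.ncard_le_ncard h2 (Set.toFinite _)
      have := hE i hi
      omega
    · set O := T.verts c \ ((R ∪ M : Finset V) : Set V) with hOdef
      have hgd : good (c, O) := by
        refine ⟨hcE, Set.sdiff_subset, ?_, hO, ?_, ?_⟩
        · rw [Set.disjoint_left]
          exact fun v hv hvR => hv.2 (Finset.mem_union_left _ hvR)
        · exact fun g hg => MultiHypergraph.exists_mem_of_mem_linkClass hO hg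
        · exact fun a ha b hb => MultiHypergraph.linked_linkClass ha hb
      have hFZ : ∀ z ∈ Z, z ∉ F (c, O) := by
        intro z hz hzF
        obtain ⟨v, hv, hvz⟩ := Set.mem_iUnion₂.1 hzF
        obtain ⟨a, -, hva⟩ := hv.1
        exact hv.2 (Finset.mem_union_right _
          (Finset.mem_filter.2 ⟨Finset.mem_biUnion.2 ⟨z, hz, hvz⟩, a, hva⟩))
      have hRlt : (T.verts c ∩ R).ncard < r := by
        by_contra hle
        obtain ⟨z, hz, hzF⟩ := hhit (c, O)
          (Finset.mem_filter.2 ⟨Finset.mem_univ _, hgd, not_lt.1 hle⟩)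
        exact hFZ z (hZ₀Z hz) hzF
      -- The subtree of the class avoids Z, so the bags of at most two nodes contain all its
      -- vertices in `M \ R`. This is the term `2 * w`.
      obtain ⟨P, hP, hPK⟩ := exists_separating_nodes hN hZ (hFsub _ hgd) hFZ
      have hsub : T.verts c ∩ ((R ∪ M : Finset V) : Set V) ⊆
          (T.verts c ∩ R) ∪ ((P.biUnion bag : Finset V) : Set V) := by
        rintro v ⟨hvc, hv⟩
        by_cases hvR : v ∈ R
        · exact Or.inl ⟨hvc, hvR⟩
        right
        have hvM : v ∈ M := (Finset.mem_union.1 hv).resolve_left hvR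
        obtain ⟨z, hz, hvz⟩ := Finset.mem_biUnion.1 (Finset.mem_filter.1 hvM).1
        obtain ⟨g, hg, hvg⟩ := hvc
        obtain ⟨p, hp, hvp⟩ := hPK {t | v ∈ bag t} (hd.isSubtree v hvR) ⟨node g,
          hd.mem_node g (hcE hg) v hvg hvR, by
            obtain ⟨u, hu, hug⟩ := hgd.2.2.2.2.1 g hg
            exact Set.mem_biUnion hu (hd.mem_node g (hcE hg) u hug
              (Set.disjoint_left.1 hgd.2.2.1 hu))⟩ ⟨z, hz, hvz⟩
        exact Finset.mem_biUnion.2 ⟨p, hp, hvp⟩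
      have c1 := Set.ncard_le_ncard hsub (Set.toFinite _)
      have c2 := Set.ncard_union_le (T.verts c ∩ R) ((P.biUnion bag : Finset V) : Set V)
      rw [Set.ncard_coe_finset] at c2
      have c3 := Finset.card_biUnion_le_card_mul P bag w fun t _ => hd.card_le t
      have c4 : P.card * w ≤ 2 * w := Nat.mul_le_mul_right _ hP
      omega

/-- If there are many hyperedges in `E`, and all others lie inside `R`, then some bounded number of
hyperedges of `E` has a small boundary and few vertices in `R`. -/
theorem IsLinkedSystem.exists_small_boundary [Finite V] [Finite ι] (hS : IsLinkedSystem G T J)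
    (hN : IsForestOrder N) {E : Set ι} {R : Finset V} {bag : N → Finset V} {node : ι → N}
    {w : ℕ} (hd : IsHyperDecomposition T E (R : Set V) bag node w) {r d : ℕ}
    (hG : ¬ HasCliqueModel G r) (hJR : ∀ i ∈ E, ∀ y ∈ R, y ∉ J i)
    (hE : ∀ i ∈ E, (T.inc i).ncard ≤ d) (hER : ∀ i ∉ E, T.inc i ⊆ R) {n : ℕ}
    (hn : ((maderBound r + 2 ^ (2 * maderBound r)) * ((1 + 2 * maderBound r * w) * R.card) + 1) * n
      ≤ E.ncard) :
    ∃ B ⊆ E, n ≤ B.ncard ∧ B.ncard ≤ 2 * n ∧ T.lam B ≤ d + r + 3 * w ∧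
      (T.verts B ∩ R).ncard ≤ d + r + 2 * w := by
  have := Fintype.ofFinite V
  have := Fintype.ofFinite ι
  obtain ⟨R₀, hR, hR₀, hJR₀, hcl⟩ := hS.exists_small_attachments hN hd hG hJR hE
  set cls : ι → Set ι := T.linkClass E (R₀ : Set V) with hcls
  set at₀ : ι → Finset V := fun i => (Set.toFinite (T.verts (cls i) ∩ R₀)).toFinset with hat₀
  have hfam := hS.isAttachedFamily R₀ (κ := cls '' E) (fun c => c.1)
    (fun c => T.verts c.1 \ (R₀ : Set V)) ?_ (fun c y hy h => h.2 hy) (fun c => Set.sdiff_subset)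
    ?_ ?_ ?_
  · have hcard : (E.toFinset.image at₀).card ≤
        (maderBound r + 2 ^ (2 * maderBound r)) * R₀.card + 1 := by
      refine le_trans (Finset.card_le_card ?_) (hfam.card_image_le hG Finset.univ)
      intro S hS
      obtain ⟨i, hi, rfl⟩ := Finset.mem_image.1 hS
      rw [Set.mem_toFinset] at hi
      exact Finset.mem_image.2 ⟨⟨cls i, i, hi, rfl⟩, Finset.mem_univ _, rfl⟩
    obtain ⟨S, hSn⟩ : ∃ S, n ≤ (E.toFinset.filter fun i => at₀ i = S).card := by
      rcases Nat.eq_zero_or_pos n with rfl | hn0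
      · exact ⟨∅, Nat.zero_le _⟩
      have hEne : E.toFinset.Nonempty := by
        rw [← Finset.card_pos, ← Set.ncard_eq_toFinset_card']
        refine lt_of_lt_of_le ?_ hn
        positivity
      obtain ⟨S, -, hS⟩ := Finset.exists_le_card_fiber_of_mul_le_card_of_maps_to
        (s := E.toFinset) (t := E.toFinset.image at₀) (f := at₀) (n := n)
        (fun i hi => Finset.mem_image_of_mem _ hi) (hEne.image _) (by
          rw [← Set.ncard_eq_toFinset_card']
          refine le_trans (Nat.mul_le_mul_right _ ?_) hn
          exact hcard.trans (Nat.add_le_add_right (Nat.mul_le_mul_left _ hR₀) 1))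
      exact ⟨S, hS⟩
    -- A vertex of I outside R₀ lies only on hyperedges of one class, all with attachment set S. If
    -- it also avoids `bag t`, these are all on the same side of the cut. So the boundary lies in `S
    -- ∪ bag t`.
    obtain ⟨t, D, I, hD, hIs, hI1, hI2, hI3, hI4⟩ := exists_split hN _ node hSn
    have hIE : ∀ i ∈ I, i ∈ E ∧ at₀ i = S := fun i hi => by
      simpa using Finset.mem_filter.1 (hIs hi)
    have hmemS : ∀ i ∈ I, ∀ v ∈ T.inc i, v ∈ R₀ → v ∈ S := by
      intro i hi v hv hvR
      rw [← (hIE i hi).2, hat₀, Set.Finite.mem_toFinset]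
      exact ⟨⟨i, MultiHypergraph.self_mem_linkClass, hv⟩, hvR⟩
    have hScard : I.Nonempty → S.card ≤ d + r + 2 * w := by
      rintro ⟨i, hi⟩
      rw [← (hIE i hi).2, hat₀, ← Set.ncard_eq_toFinset_card]
      exact hcl i (hIE i hi).1
    refine ⟨I, fun i hi => (hIE i hi).1, ?_, ?_, ?_, ?_⟩
    · rwa [Set.ncard_coe_finset]
    · rwa [Set.ncard_coe_finset]
    · rcases I.eq_empty_or_nonempty with rfl | hne
      · simp [MultiHypergraph.lam, MultiHypergraph.bd, MultiHypergraph.verts]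
      have hsub : T.bd (I : Set ι) ⊆ ((S ∪ bag t : Finset V) : Set V) := by
        rintro v ⟨⟨a, ha, hva⟩, b, hb, hvb⟩
        rw [Finset.mem_coe, Finset.mem_union]
        by_cases hvR : v ∈ R₀
        · exact Or.inl (hmemS a ha v hva hvR)
        right
        have haE := (hIE a ha).1
        have hvR' : v ∉ R := fun h => hvR (hR h)
        have hbE : b ∈ E := by
          by_contra h
          exact hvR' (hER b h hvb)
        have hbat : at₀ b = S := by
          have hbc : cls b = cls a :=
            MultiHypergraph.linkClass_eq (MultiHypergraph.mem_linkClass_of_mem haE hbE hvR hva hvb)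
          rw [← (hIE a ha).2]
          simp only [hat₀, hbc]
        by_contra hvt
        have hna : node a ∈ D := by
          rcases hI4 a ha with h | h
          · exact h
          · exact absurd (h ▸ hd.mem_node a haE v hva hvR') hvt
        have hnb := hD.subset_of_mem hN (hd.isSubtree v hvR') hvt
          (hd.mem_node a haE v hva hvR') hna (hd.mem_node b hbE v hvb hvR')
        exact hb (hI3 b (by simpa using ⟨hbE, hbat⟩) hnb)
      have c1 := Set.ncard_le_ncard hsub (Set.toFinite _)
      rw [Set.ncard_coe_finset] at c1
      have c2 := Finset.card_union_le S (bag t)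
      have c3 := hScard hne
      have c4 := hd.card_le t
      change (T.bd (I : Set ι)).ncard ≤ _
      omega
    · rcases I.eq_empty_or_nonempty with rfl | hne
      · simp [MultiHypergraph.verts]
      refine le_trans (Set.ncard_le_ncard (t := (S : Set V)) ?_ (Set.toFinite _)) ?_
      · rintro v ⟨⟨a, ha, hva⟩, hvR⟩
        exact hmemS a ha v hva (hR hvR)
      · rw [Set.ncard_coe_finset]
        exact hScard hne
  · rintro ⟨_, i, hi, rfl⟩ j hj
    exact hJR₀ j (MultiHypergraph.linkClass_subset hi hj)
  · rintro ⟨_, i, hi, rfl⟩ ⟨_, i', hi', rfl⟩ hne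
    rw [Set.disjoint_left]
    intro a ha ha'
    apply hne
    apply Subtype.ext
    exact (MultiHypergraph.linkClass_eq ha).symm.trans (MultiHypergraph.linkClass_eq ha')
  · rintro ⟨_, i, hi, rfl⟩ ⟨_, i', hi', rfl⟩ hne
    rw [Set.disjoint_left]
    rintro v ⟨⟨a, ha, hva⟩, hv⟩ ⟨⟨b, hb, hvb⟩, -⟩
    apply hne
    apply Subtype.ext
    have hab : b ∈ cls a := MultiHypergraph.mem_linkClass_of_mem
      (MultiHypergraph.linkClass_subset hi ha) (MultiHypergraph.linkClass_subset hi' hb) hv hva hvb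
    exact (MultiHypergraph.linkClass_eq ha).symm.trans
      ((MultiHypergraph.linkClass_eq hab).symm.trans (MultiHypergraph.linkClass_eq hb))
  · rintro ⟨_, i, hi, rfl⟩ a ha b hb
    exact MultiHypergraph.linked_linkClass ha hb

end Attachments

end Mergeable

namespace Mergeable

/-! ### Explicit bounds and the main result -/

noncomputable section Bounds

open scoped Classical

universe u v w

/-- A bound on the adhesions of all but few children of the root. -/
def adhesionBound (h e : ℕ) : ℕ := 6 * (e + 1) + 2 + h

/-- A bound on the bags of a tree decomposition of a large part of the torso. -/
def bagBound (h e : ℕ) : ℕ := (e + 1) * (adhesionBound h e + 1)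

/-- The bound on the boundary and on the internal treewidth. -/
def boundaryBound (h e : ℕ) : ℕ := e + adhesionBound h e + h + 3 * bagBound h e

/-- The number of hyperedges that are cut off before they are grouped by boundaries. -/
def groupSize (h e : ℕ) : ℕ := 2 ^ (2 * boundaryBound h e + 2)

/-- The number of children of the root, relative to the size of the modulator, that suffices. -/
def childBound (h e α : ℕ) : ℕ :=
  (1 + maderBound h) + ((maderBound h + 2 ^ (2 * maderBound h)) *
    ((1 + 2 * maderBound h * bagBound h e) * (1 + α * (1 + maderBound h))) + 1) * groupSize h e

section Main

variable {V : Type u} [Finite V] {G : SimpleGraph V} {ι : Type v}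

/-- Well-linkedness connects the boundary of `L i` through its interior, and an interior vertex lies
on no hyperedge outside `L i`. -/
theorem isLinkedSystem_torso {L : ι → Set (V ⊕ G.edgeSet)}
    (hdis : ∀ i j, i ≠ j → Disjoint (L i) (L j))
    (hwl : ∀ i, (supportHypergraph G).WellLinked (L i)) {T : MultiHypergraph V ι}
    (hT : ∀ i, T.inc i = (supportHypergraph G).bd (L i)) :
    IsLinkedSystem G T fun i => (supportHypergraph G).interior (L i) := by
  have hout : ∀ i j, i ≠ j → ∀ v ∈ (supportHypergraph G).verts (L j),
      v ∉ (supportHypergraph G).interior (L i) := by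
    rintro i j hij v ⟨e, he, hve⟩ ⟨hv, hvb⟩
    exact hvb ⟨hv, e, fun h => Set.disjoint_left.1 (hdis i j hij) h he, hve⟩
  refine ⟨fun i j hij => ?_, fun i j x hx hxi => ?_, fun i x hx y hy => ?_⟩
  · rw [Set.disjoint_left]
    exact fun v hv hv' => hout i j hij v hv'.1 hv
  · rw [hT] at hx
    by_cases hij : i = j
    · subst hij
      exact hxi.2 hx
    · exact hout i j hij x hx.1 hxi
  · rw [hT] at hx hy
    exact WellLinked.connIn (hwl i) hx hy

/-- All but few of the disjoint well-linked sets avoid the modulator in their interior and have few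
of its vertices on the boundary. -/
theorem card_bad_le [Finite ι] {L : ι → Set (V ⊕ G.edgeSet)} {T : MultiHypergraph V ι}
    (hS : IsLinkedSystem G T fun i => (supportHypergraph G).interior (L i)) {h : ℕ}
    (hG : ¬ HasCliqueModel G h) (X : Finset V) :
    {i | ¬ (Disjoint ((supportHypergraph G).interior (L i)) (X : Set V) ∧
      (T.inc i ∩ X).ncard < h)}.ncard ≤ (1 + maderBound h) * X.card := by
  have := Fintype.ofFinite ι
  set B₁ : Set ι := {i | ¬ Disjoint ((supportHypergraph G).interior (L i)) (X : Set V)} with hB₁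
  set B₂ : Set ι := {i | Disjoint ((supportHypergraph G).interior (L i)) (X : Set V) ∧
    h ≤ (T.inc i ∩ X).ncard} with hB₂
  have h₁ : B₁.ncard ≤ X.card := by
    rcases B₁.eq_empty_or_nonempty with h0 | ⟨i₀, hi₀⟩
    · simp [h0]
    have hex : ∀ i ∈ B₁, ∃ x, x ∈ (supportHypergraph G).interior (L i) ∧ x ∈ X :=
      fun i hi => Set.not_disjoint_iff.1 hi
    have : Nonempty V := ⟨(hex i₀ hi₀).choose⟩
    choose! f hf using hex
    rw [← Set.ncard_coe_finset X]
    refine Set.ncard_le_ncard_of_injOn f (fun i hi => (hf i hi).2) ?_ (Set.toFinite _)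
    intro i hi j hj hij
    by_contra hne
    exact Set.disjoint_left.1 (hS.disjoint i j hne) (hf i hi).1 (hij ▸ (hf j hj).1)
  -- Single hyperedges already form an attached family on X, with no linking vertices.
  have h₂ : B₂.ncard ≤ maderBound h * X.card := by
    have hfam := hS.isAttachedFamily X (κ := B₂) (fun i => {i.1}) (fun _ => ∅)
      (by
        rintro ⟨j, hj⟩ i rfl y hy hyi
        exact Set.disjoint_left.1 hj.1 hyi hy)
      (by simp) (by simp) (by
        intro i j hij
        rw [Set.disjoint_singleton]
        exact fun h => hij (Subtype.ext h)) (by simp) (by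
        rintro i a rfl b rfl
        exact Relation.ReflTransGen.refl)
    have := hfam.card_le_of_le_card hG Finset.univ fun j _ => by
      rw [← Set.ncard_eq_toFinset_card]
      refine j.2.2.trans (Set.ncard_le_ncard ?_ (Set.toFinite _))
      exact Set.inter_subset_inter_left _ fun x hx => ⟨j.1, rfl, hx⟩
    rw [Finset.card_univ, ← Nat.card_eq_fintype_card] at this
    exact this
  refine (Set.ncard_le_ncard (t := B₁ ∪ B₂) ?_ (Set.toFinite _)).trans
    ((Set.ncard_union_le _ _).trans ?_)
  · intro i hi
    by_cases hd : Disjoint ((supportHypergraph G).interior (L i)) (X : Set V)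
    · exact Or.inr ⟨hd, not_lt.1 fun hlt => hi ⟨hd, hlt⟩⟩
    · exact Or.inl hd
  · rw [add_mul, one_mul]
    exact Nat.add_le_add h₁ h₂

/-- The main result for a family of pairwise disjoint well-linked sets. -/
theorem exists_mergeable_of_wellLinked [Finite ι] {L : ι → Set (V ⊕ G.edgeSet)}
    (hdis : ∀ i j, i ≠ j → Disjoint (L i) (L j))
    (hwl : ∀ i, (supportHypergraph G).WellLinked (L i)) {T : MultiHypergraph V ι}
    (hT : ∀ i, T.inc i = (supportHypergraph G).bd (L i)) {h e α : ℕ}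
    (hα : ∀ i, (T.inc i).ncard ≤ α) (hG : ¬ HasCliqueModel G h) {X : Finset V}
    (hX : IsTreewidthModulator G e X) (hk : 1 ≤ X.card)
    (hc : childBound h e α * X.card ≤ Nat.card ι) :
    ∃ B : Set ι, T.lam B ≤ boundaryBound h e ∧
      (supportHypergraph G).itw {a | ∃ i ∈ B, a ∈ L i} ≤ (boundaryBound h e : ℤ) ∧
      2 ^ (boundaryBound h e + 2) ≤ B.ncard ∧ B.ncard ≤ 2 * groupSize h e ∧
      ∀ B', T.IsInternalComponent B B' → T.bd B' = T.bd B := by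
  have := Fintype.ofFinite V
  have := Fintype.ofFinite ι
  set H := supportHypergraph G with hH
  have hS := isLinkedSystem_torso hdis hwl hT
  have hbad := card_bad_le hS hG X
  obtain ⟨N, _, _, _, bag, hN, hd⟩ := exists_rootedDecomposition G hX
  rw [Int.toNat_natCast] at hd
  set E : Set ι := {i | Disjoint (H.interior (L i)) (X : Set V) ∧ (T.inc i ∩ X).ncard < h} with hE
  have hEc : Eᶜ.ncard ≤ (1 + maderBound h) * X.card := hbad
  have hEd : ∀ i ∈ E, (T.inc i).ncard ≤ adhesionBound h e := by
    intro i hi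
    rw [hT]
    refine WellLinked.lam_le hN hd (hwl i) hi.1 (m := h) ?_
    rw [← hT]
    exact hi.2.le
  -- Absorbing the adhesions of bad children puts every torso hyperedge outside E into R. This is
  -- where α enters `childBound`.
  set R : Finset V := X ∪ Eᶜ.toFinset.biUnion fun i => (T.inc i).toFinset with hR
  have hRc : R.card ≤ (1 + α * (1 + maderBound h)) * X.card := by
    have h1 : (Eᶜ.toFinset.biUnion fun i => (T.inc i).toFinset).card ≤ Eᶜ.toFinset.card * α := by
      refine Finset.card_biUnion_le_card_mul _ _ _ fun i _ => ?_
      rw [← Set.ncard_eq_toFinset_card']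
      exact hα i
    rw [← Set.ncard_eq_toFinset_card'] at h1
    calc R.card ≤ X.card + Eᶜ.ncard * α := (Finset.card_union_le _ _).trans (by omega)
      _ ≤ X.card + ((1 + maderBound h) * X.card) * α :=
        Nat.add_le_add_left (Nat.mul_le_mul_right _ hEc) _
      _ = _ := by ring
  have hXR : (X : Set V) ⊆ R := fun x hx => Finset.mem_union_left _ hx
  have hER : ∀ i ∉ E, T.inc i ⊆ R := fun i hi x hx => Finset.mem_union_right _
    (Finset.mem_biUnion.2 ⟨i, Set.mem_toFinset.2 hi, Set.mem_toFinset.2 hx⟩)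
  have hJR : ∀ i ∈ E, ∀ y ∈ R, y ∉ H.interior (L i) := by
    intro i hi y hy hyi
    rcases Finset.mem_union.1 hy with hy | hy
    · exact Set.disjoint_left.1 hi.1 hyi hy
    · obtain ⟨j, -, hj⟩ := Finset.mem_biUnion.1 hy
      exact hS.notMem i j y (Set.mem_toFinset.1 hj) hyi
  obtain ⟨bag', node, hd'⟩ := hS.exists_hyperDecomposition hN hd hXR (fun i hi => hi.1) hEd
  have hcard : ((maderBound h + 2 ^ (2 * maderBound h)) *
      ((1 + 2 * maderBound h * bagBound h e) * R.card) + 1) * groupSize h e ≤ E.ncard := by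
    set q := maderBound h + 2 ^ (2 * maderBound h) with hq
    set s := 1 + 2 * maderBound h * bagBound h e with hs
    set ρ := 1 + α * (1 + maderBound h) with hρ
    have h1 : E.ncard + Eᶜ.ncard = Nat.card ι := Set.ncard_add_ncard_compl E
    have h2 : childBound h e α * X.card = (1 + maderBound h) * X.card +
        (q * (s * (ρ * X.card)) + X.card) * groupSize h e := by
      rw [childBound, ← hq, ← hs, ← hρ]
      ring
    -- The summand 1 is absorbed by `1 ≤ X.card`.
    have h3 : (q * (s * R.card) + 1) * groupSize h e ≤
        (q * (s * (ρ * X.card)) + X.card) * groupSize h e :=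
      Nat.mul_le_mul_right _ (Nat.add_le_add
        (Nat.mul_le_mul_left _ (Nat.mul_le_mul_left _ hRc)) hk)
    omega
  obtain ⟨B₀, hB₀E, hB₀1, hB₀2, hB₀l, hB₀R⟩ :=
    hS.exists_small_boundary hN hd' hG hJR hEd hER hcard
  rw [← bagBound] at hB₀l hB₀R
  have hγ : T.lam B₀ ≤ boundaryBound h e := by
    rw [boundaryBound]
    omega
  obtain ⟨B, hBB₀, hBl, hBc, hBi⟩ := MultiHypergraph.exists_uniform_subset B₀ hγ
  refine ⟨B, hBl, ?_, ?_, (Set.ncard_le_ncard hBB₀ (Set.toFinite _)).trans hB₀2, hBi⟩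
  -- The sets `L i` for i in B have interiors disjoint from X, so modulator vertices inside the
  -- expansion are torso vertices in R, of which there are few.
  · rw [MultiHypergraph.itw, hH, primal_supportHypergraph]
    refine (treewidth_induce_le G hX _ (m := adhesionBound h e + h + 2 * bagBound h e)
      (le_trans (Set.ncard_le_ncard ?_ (Set.toFinite _)) hB₀R)).trans ?_
    · rintro v ⟨⟨⟨a, ⟨i, hi, hai⟩, hva⟩, -⟩, hvX⟩
      refine ⟨⟨i, hBB₀ hi, ?_⟩, hXR hvX⟩
      rw [hT]
      by_contra hvb
      exact Set.disjoint_left.1 (hB₀E (hBB₀ hi)).1 ⟨⟨a, hai, hva⟩, hvb⟩ hvX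
    · rw [boundaryBound]
      push_cast
      omega
  -- `groupSize` is 2^γ * 2^(γ+2) with γ = `boundaryBound h e`; the first factor pays for the
  -- grouping by boundaries.
  · have h1 : 2 ^ boundaryBound h e * 2 ^ (boundaryBound h e + 2) ≤
        2 ^ boundaryBound h e * B.ncard := by
      refine le_trans (le_of_eq ?_) (hB₀1.trans hBc)
      rw [groupSize, ← pow_add]
      congr 1
      ring
    exact Nat.le_of_mul_le_mul_left h1 (by positivity)

end Main

/-! ### Children of the root -/

section Superbranch

variable {V : Type u} {E : Type v} {X : MultiHypergraph V E} {N : Type w}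

theorem SuperbranchDecomposition.ne_root_of_mem_rootChildren (D : SuperbranchDecomposition X N)
    {s : N} (hs : s ∈ D.rootChildren) : s ≠ D.root := fun h => hs.1.ne h.symm

/-- Two ancestors of the same leaf are comparable, but the path from the root to a child contains no
other child. -/
theorem SuperbranchDecomposition.disjoint_below (D : SuperbranchDecomposition X N) {s s' : N}
    (hs : s ∈ D.rootChildren) (hs' : s' ∈ D.rootChildren) (hne : s ≠ s') :
    Disjoint (D.below s) (D.below s') := by
  have key : ∀ a b, a ∈ D.rootChildren → b ∈ D.rootChildren →
      IsAncestor D.tree D.root a b → a = b := by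
    intro a b ha hb hab
    have hp : hb.1.toWalk.IsPath := by
      rw [SimpleGraph.Walk.isPath_def]
      simpa using hb.1.ne
    have := hab.mem_support D.isTree hp
    simp only [SimpleGraph.Adj.toWalk, SimpleGraph.Walk.support_cons,
      SimpleGraph.Walk.support_nil, List.mem_cons, List.not_mem_nil, or_false] at this
    exact this.resolve_left (D.ne_root_of_mem_rootChildren ha)
  rw [Set.disjoint_left]
  intro e he he'
  rcases IsAncestor.total D.isTree he he' with h | h
  · exact hne (key s s' hs hs' h)
  · exact hne (key s' s hs' hs h).symm

end Superbranch

/-! ### Computability of the bounds -/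

section Computability

/-- Lets the natural number `Encodable.encode η` replace η in all bounds, whatever the sign of η. -/
theorem le_encode_int (η : ℤ) : η ≤ (Encodable.encode η : ℤ) := by
  rcases η with n | n
  · change (n : ℤ) ≤ ((2 * n : ℕ) : ℤ)
    omega
  · change Int.negSucc n ≤ ((2 * n + 1 : ℕ) : ℤ)
    omega

theorem primrec_pow {α : Type u} [Primcodable α] {f g : α → ℕ} (hf : Primrec f) (hg : Primrec g) :
    Primrec fun a => f a ^ g a := by
  have h : Primrec₂ (fun m n : ℕ => m ^ n) := Primrec₂.unpaired'.1 Nat.Primrec.pow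
  exact h.comp hf hg

variable {α : Type u} [Primcodable α] {h e a : α → ℕ} (hh : Primrec h) (he : Primrec e)
  (ha : Primrec a)

theorem primrec_add {f g : α → ℕ} (hf : Primrec f) (hg : Primrec g) :
    Primrec fun x => f x + g x := Primrec.nat_add.comp hf hg

theorem primrec_mul {f g : α → ℕ} (hf : Primrec f) (hg : Primrec g) :
    Primrec fun x => f x * g x := Primrec.nat_mul.comp hf hg

include hh

theorem primrec_maderBound : Primrec fun x => maderBound (h x) :=
  primrec_mul (primrec_pow (.const 2) (primrec_mul hh hh)) (primrec_add hh (.const 1))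

include he

theorem primrec_adhesionBound : Primrec fun x => adhesionBound (h x) (e x) :=
  primrec_add (primrec_add (primrec_mul (.const 6) (primrec_add he (.const 1))) (.const 2)) hh

theorem primrec_bagBound : Primrec fun x => bagBound (h x) (e x) :=
  primrec_mul (primrec_add he (.const 1))
    (primrec_add (primrec_adhesionBound hh he) (.const 1))

theorem primrec_boundaryBound : Primrec fun x => boundaryBound (h x) (e x) :=
  primrec_add (primrec_add (primrec_add he (primrec_adhesionBound hh he)) hh)
    (primrec_mul (.const 3) (primrec_bagBound hh he))

theorem primrec_groupSize : Primrec fun x => groupSize (h x) (e x) :=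
  primrec_pow (.const 2)
    (primrec_add (primrec_mul (.const 2) (primrec_boundaryBound hh he)) (.const 2))

include ha

theorem primrec_childBound : Primrec fun x => childBound (h x) (e x) (a x) :=
  have hD := primrec_maderBound hh
  primrec_add (primrec_add (.const 1) hD) (primrec_mul (primrec_add (primrec_mul
    (primrec_add hD (primrec_pow (.const 2) (primrec_mul (.const 2) hD)))
    (primrec_mul (primrec_add (.const 1) (primrec_mul (primrec_mul (.const 2) hD)
      (primrec_bagBound hh he)))
      (primrec_add (.const 1) (primrec_mul ha (primrec_add (.const 1) hD))))) (.const 1))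
    (primrec_groupSize hh he))

end Computability

end Bounds

end Mergeable

open Mergeable
theorem mainTheorem4 :
    ∃ (γ : GraphCode × ℤ → ℕ) (c : GraphCode × ℤ × ℕ → ℕ) (C : GraphCode × ℤ → ℕ),
      Computable γ ∧ Computable c ∧ Computable C ∧
      ∀ (H : GraphCode) (η : ℤ) (α k : ℕ), 1 ≤ k →
      ∀ (V : Type*) [Finite V] (G : SimpleGraph V),
        ¬ IsTopologicalMinor H.graph G →
        (∃ X : Finset V, X.card = k ∧ IsTreewidthModulator G η X) →
      ∀ (N : Type*) [Finite N] (D : SuperbranchDecomposition (supportHypergraph G) N),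
        D.DownwardsWellLinked →
        D.HasAdhesionSize α →
        c (H, η, α) * k ≤ D.rootChildren.ncard →
        ∃ B : Set D.rootChildren,
          D.rootTorso.lam B ≤ γ (H, η) ∧
          (supportHypergraph G).itw (D.expand B) ≤ (γ (H, η) : ℤ) ∧
          2 ^ (γ (H, η) + 2) ≤ B.ncard ∧
          B.ncard ≤ C (H, η) * max α 1 ∧
          ∀ B' : Set D.rootChildren, D.rootTorso.IsInternalComponent B B' →
            D.rootTorso.bd B' = D.rootTorso.bd B := by
  have h₂ : Primrec fun p : GraphCode × ℤ => p.1.1 := Primrec.fst.comp Primrec.fst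
  have e₂ : Primrec fun p : GraphCode × ℤ => Encodable.encode p.2 :=
    Primrec.encode.comp Primrec.snd
  have h₃ : Primrec fun p : GraphCode × ℤ × ℕ => p.1.1 := Primrec.fst.comp Primrec.fst
  have e₃ : Primrec fun p : GraphCode × ℤ × ℕ => Encodable.encode p.2.1 :=
    Primrec.encode.comp (Primrec.fst.comp Primrec.snd)
  have a₃ : Primrec fun p : GraphCode × ℤ × ℕ => p.2.2 := Primrec.snd.comp Primrec.snd
  -- H enters only through its number of vertices `p.1.1`. The bound on `B.ncard` is independent of
  -- α, so the factor `max α 1` is needed only to be positive.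
  refine ⟨fun p => boundaryBound p.1.1 (Encodable.encode p.2),
    fun p => childBound p.1.1 (Encodable.encode p.2.1) p.2.2,
    fun p => 2 * groupSize p.1.1 (Encodable.encode p.2),
    (primrec_boundaryBound h₂ e₂).to_comp, (primrec_childBound h₃ e₃ a₃).to_comp,
    (primrec_mul (.const 2) (primrec_groupSize h₂ e₂)).to_comp, ?_⟩
  rintro H η α k hk V _ G hG ⟨X, rfl, hX⟩ N _ D hwl hα hc
  obtain ⟨B, h1, h2, h3, h4, h5⟩ := exists_mergeable_of_wellLinked (G := G) (T := D.rootTorso)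
    (L := fun s : D.rootChildren => D.below s) (h := H.1) (e := Encodable.encode η) (α := α)
    (fun s s' hne => D.disjoint_below s.2 s'.2 fun h => hne (Subtype.ext h))
    (fun s => hwl s) (fun _ => rfl)
    (fun s => hα s (D.ne_root_of_mem_rootChildren s.2))
    (fun hm => hG (hm.isTopologicalMinor G _)) (X := X)
    (le_trans hX (le_encode_int η)) hk (by simpa [Nat.card_coe_set_eq] using hc)
  exact ⟨B, h1, h2, h3, h4.trans (Nat.le_mul_of_pos_right _ (by omega)), h5⟩
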